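/- Let $D$ be a finite set and $\Gamma$ a finite set of relations (of finite arities) on $D$. An instance $\mathcal P=(V,\mathcal C)$ of $\#\mathrm{CSP}(\Gamma)$ consists of a finite set $V$ of variables and a finite set $\mathcal C$ of constraints $\langle \mathbf s, Q\rangle$, where $Q\in\Gamma$ and $\mathbf s$ is a tuple of variables (repetitions allowed) whose length is the arity of $Q$. A solution is a map $\varphi:V\to D$ with $\varphi(\mathbf s)\in Q$ for all constraints $\langle\mathbf s,Q\rangle\in\mathcal C$. The problem asks for the number $\#\mathcal P$ of solutions. Let $R\subseteq D^n$. A max-implementation of $R$ by $\Gamma$ is an instance $\mathcal P$ of $\#\mathrm{CSP}(\Gamma)$ whose set of variables is a disjoint union of $V_x=\{x_1,\dots,x_n\}$ and $V_y=\{y_1,\dots,y_q\}$ such that, for every assignment $\varphi:V_x\to D$ (identified with a tuple in $D^n$), $\varphi\in R$ if and only if the number $\#\varphi$ of assignments $\psi:V_y\to D$ for which $\varphi\cup\psi$ is a solution of $\mathcal P$ is maximal among all assignments of $V_x$. An output approximates $\#\mathcal P$ with relative error less than $\varepsilon$ if it is a number $N$ with $N=0$ when $\#\mathcal P=0$, and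 $|\#\mathcal P-N|/\#\mathcal P<\varepsilon$ otherwise. A counting problem $A$ is AP-reducible to a counting problem $B$ if there is a deterministic algorithm that uses an oracle for $B$, takes as input an instance $\mathcal P$ of $A$ and an error bound $0<\varepsilon<1$, and satisfies: (i) every oracle call is a pair $(\mathcal P',\delta)$, where $\mathcal P'$ is an instance of $B$ and $0<\delta<1$ with $\log(1/\delta)$ bounded by a polynomial in the size of $\mathcal P$ and $\log(1/\varepsilon)$; (ii) whenever the oracle answers all inputs $(\mathcal P',\delta)$ with relative error less than $\delta$, the algorithm outputs on every $(\mathcal P,\varepsilon)$ an approximation of $\#\mathcal P$ with relative error less than $\varepsilon$; (iii) for every oracle whose answers have length polynomially bounded in the length of the question, the algorithm halts in time polynomial in the size of $\mathcal P$ and $\log(1/\varepsilon)$, where the polynomial depends only on the one that bounds the lengths of the answers. Error bounds are given to algorithms and oracles as the binary numeral $\lceil 1/\varepsilon\rceil$, outputs are fractions of natural numbers, and an instance is written as the list of its variables together with the list of its constraints. **Theorem.** If there is a max-implementation of $R$ by $\Gamma$, then $\#\mathrm{CSP}(\Gamma\cup\{R\})$ is AP-reducible to $\#\mathrm{CSP}(\Gamma)$.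 -/

import Mathlib

namespace CountingCSP

/-! ## Oracle algorithms with a running time -/

/-- The objects handled by an algorithm: natural numbers and ordered pairs of objects. -/
inductive Data where
  | num (n : ℕ) : Data
  | pair (a b : Data) : Data

namespace Data

/-- The length of an object; natural numbers are written in binary. -/
def size : Data → ℕ
  | num n => Nat.size n + 1
  | pair a b => a.size + b.size + 1

/-- A list, written as nested pairs that end in `0`. -/
def ofList : List Data → Data
  | [] => num 0
  | a :: l => pair a (ofList l)

/-- A list of natural numbers. -/
def ofNats (l : List ℕ) : Data := ofList (l.map num)

end Data

/-- The elementary operations. -/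
inductive Op where
  | id : Op
  | const (n : ℕ) : Op
  | fst : Op
  | snd : Op
  | isPair : Op
  | add : Op
  | sub : Op
  | mul : Op
  | div : Op

namespace Op

/-- The result of an elementary operation (`0` on an argument of the wrong shape; subtraction is
truncated and division is integer division). -/
def eval : Op → Data → Data
  | id, x => x
  | const n, _ => .num n
  | fst, .pair a _ => a
  | snd, .pair _ b => b
  | isPair, .pair _ _ => .num 1
  | add, .pair (.num a) (.num b) => .num (a + b)
  | sub, .pair (.num a) (.num b) => .num (a - b)
  | mul, .pair (.num a) (.num b) => .num (a * b)
  | div, .pair (.num a) (.num b) => .num (a / b)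
  | _, _ => .num 0

end Op

/-- Deterministic programs with an oracle. Each takes one object and, if it halts, returns one.
`seq p q` runs `p`, then `q` on its result; `fork p q` runs both on the same input and pairs the
results; `ite c p q` and `loop c p` branch and iterate as long as the test `c` does not return
`0`; `oracle` replaces its input by the answer of the oracle. -/
inductive Prog where
  | op (o : Op) : Prog
  | seq (p q : Prog) : Prog
  | fork (p q : Prog) : Prog
  | ite (c p q : Prog) : Prog
  | loop (c p : Prog) : Prog
  | oracle : Prog

/-- `Run O p x y t Q`: with the oracle `O`, the program `p` halts on `x` with the result `y`, its
running time is `t`, and `Q` is the list of its oracle calls. Time is counted by the logarithmic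
cost criterion: an elementary operation or an oracle call costs the length of its argument plus
the length of its result, and control costs one unit. -/
inductive Run (O : Data → Data) : Prog → Data → Data → ℕ → List Data → Prop where
  | op (o : Op) (x : Data) : Run O (.op o) x (o.eval x) (x.size + (o.eval x).size) []
  | seq {p q : Prog} {x y z : Data} {s t : ℕ} {Q Q' : List Data} :
      Run O p x y s Q → Run O q y z t Q' → Run O (.seq p q) x z (s + t + 1) (Q ++ Q')
  | fork {p q : Prog} {x y z : Data} {s t : ℕ} {Q Q' : List Data} :
      Run O p x y s Q → Run O q x z t Q' →
        Run O (.fork p q) x (.pair y z) (s + t + 1) (Q ++ Q')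
  | ite_true {c p q : Prog} {x b y : Data} {s t : ℕ} {Q Q' : List Data} :
      Run O c x b s Q → b ≠ .num 0 → Run O p x y t Q' →
        Run O (.ite c p q) x y (s + t + 1) (Q ++ Q')
  | ite_false {c p q : Prog} {x y : Data} {s t : ℕ} {Q Q' : List Data} :
      Run O c x (.num 0) s Q → Run O q x y t Q' →
        Run O (.ite c p q) x y (s + t + 1) (Q ++ Q')
  | loop_true {c p : Prog} {x b y z : Data} {s t u : ℕ} {Q Q' Q'' : List Data} :
      Run O c x b s Q → b ≠ .num 0 → Run O p x y t Q' → Run O (.loop c p) y z u Q'' →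
        Run O (.loop c p) x z (s + t + u + 1) (Q ++ Q' ++ Q'')
  | loop_false {c p : Prog} {x : Data} {s : ℕ} {Q : List Data} :
      Run O c x (.num 0) s Q → Run O (.loop c p) x x (s + 1) Q
  | oracle (x : Data) : Run O .oracle x (O x) (x.size + (O x).size) [x]

/-- Programs are deterministic, so "the" run of a program on an input makes sense. -/
theorem Run.deterministic {O : Data → Data} {p : Prog} {x y : Data} {t : ℕ} {Q : List Data}
    (h : Run O p x y t Q) :
    ∀ {y' : Data} {t' : ℕ} {Q' : List Data}, Run O p x y' t' Q' → y = y' ∧ t = t' ∧ Q = Q' := by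
  induction h with
  | op o x => intro _ _ _ h'; cases h'; exact ⟨rfl, rfl, rfl⟩
  | oracle x => intro _ _ _ h'; cases h'; exact ⟨rfl, rfl, rfl⟩
  | seq _ _ ih₁ ih₂ =>
    intro _ _ _ h'
    cases h' with
    | seq a b =>
      obtain ⟨rfl, rfl, rfl⟩ := ih₁ a
      obtain ⟨rfl, rfl, rfl⟩ := ih₂ b
      exact ⟨rfl, rfl, rfl⟩
  | fork _ _ ih₁ ih₂ =>
    intro _ _ _ h'
    cases h' with
    | fork a b =>
      obtain ⟨rfl, rfl, rfl⟩ := ih₁ a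
      obtain ⟨rfl, rfl, rfl⟩ := ih₂ b
      exact ⟨rfl, rfl, rfl⟩
  | ite_true _ hb _ ih₁ ih₂ =>
    intro _ _ _ h'
    cases h' with
    | ite_true a _ b =>
      obtain ⟨rfl, rfl, rfl⟩ := ih₁ a
      obtain ⟨rfl, rfl, rfl⟩ := ih₂ b
      exact ⟨rfl, rfl, rfl⟩
    | ite_false a _ => exact absurd (ih₁ a).1 hb
  | ite_false _ _ ih₁ ih₂ =>
    intro _ _ _ h'
    cases h' with
    | ite_true a hb _ => exact absurd (ih₁ a).1.symm hb
    | ite_false a b =>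
      obtain ⟨-, rfl, rfl⟩ := ih₁ a
      obtain ⟨rfl, rfl, rfl⟩ := ih₂ b
      exact ⟨rfl, rfl, rfl⟩
  | loop_true _ hb _ _ ih₁ ih₂ ih₃ =>
    intro _ _ _ h'
    cases h' with
    | loop_true a _ b c =>
      obtain ⟨rfl, rfl, rfl⟩ := ih₁ a
      obtain ⟨rfl, rfl, rfl⟩ := ih₂ b
      obtain ⟨rfl, rfl, rfl⟩ := ih₃ c
      exact ⟨rfl, rfl, rfl⟩
    | loop_false a => exact absurd (ih₁ a).1 hb
  | loop_false _ ih₁ =>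
    intro _ _ _ h'
    cases h' with
    | loop_true a hb _ _ => exact absurd (ih₁ a).1.symm hb
    | loop_false a =>
      obtain ⟨-, rfl, rfl⟩ := ih₁ a
      exact ⟨rfl, rfl, rfl⟩

/-! ## Approximate counting and AP-reductions -/

/-- A counting problem: instances, the way they are written down, and the number to be found. -/
structure CountingProblem where
  Inst : Type*
  encode : Inst → Data
  count : Inst → ℕ

namespace CountingProblem

/-- The input `(P, ε)` of an approximation scheme. The error bound `ε` is written as the binary
numeral `⌈1/ε⌉`, whose length is that of `log (1/ε)`. -/
noncomputable def input (A : CountingProblem) (P : A.Inst) (ε : ℝ) : Data :=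
  .pair (A.encode P) (.num ⌈1 / ε⌉₊)

/-- The parameter in which running times are polynomial: the size of `P` plus `log₂ (1/ε)`
(rounded up). A polynomial in both quantities is bounded by a polynomial in their sum. -/
noncomputable def parameter (A : CountingProblem) (P : A.Inst) (ε : ℝ) : ℕ :=
  (A.encode P).size + ⌈Real.logb 2 (1 / ε)⌉₊

end CountingProblem

/-- The output `y` is a number `a / b` that approximates `N` with relative error less than `ε`
(and equals `0` if `N = 0`). -/
def IsApprox (y : Data) (N : ℕ) (ε : ℝ) : Prop :=
  ∃ a b : ℕ, b ≠ 0 ∧ y = .pair (.num a) (.num b) ∧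
    (N = 0 → a = 0) ∧ (N ≠ 0 → |(N : ℝ) - (a : ℝ) / (b : ℝ)| / (N : ℝ) < ε)

/-- The oracle `O` answers every input of the counting problem `B` within the error bound. -/
def AccurateFor (B : CountingProblem) (O : Data → Data) : Prop :=
  ∀ (P : B.Inst) (δ : ℝ), 0 < δ → δ < 1 → IsApprox (O (B.input P δ)) (B.count P) δ

/-- The answers of the oracle `O` have length at most `q` of the length of the question, as the
answers of any algorithm of running time `q` do. -/
def AnswersWithin (q : Polynomial ℕ) (O : Data → Data) : Prop :=
  ∀ x : Data, (O x).size ≤ q.eval x.size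

/-- `A` is AP-reducible to `B`. The oracle is an arbitrary function, not only a computable one. -/
def APReducible (A B : CountingProblem) : Prop :=
  ∃ alg : Prog,
    -- every oracle call is a pair `(P', δ)` with `log (1/δ)` polynomially bounded
    (∃ r : Polynomial ℕ, ∀ (O : Data → Data) (P : A.Inst) (ε : ℝ), 0 < ε → ε < 1 →
      ∀ (y : Data) (t : ℕ) (Q : List Data), Run O alg (A.input P ε) y t Q →
        ∀ c ∈ Q, ∃ (P' : B.Inst) (δ : ℝ), 0 < δ ∧ δ < 1 ∧ c = B.input P' δ ∧
          Real.logb 2 (1 / δ) ≤ (r.eval (A.parameter P ε) : ℕ)) ∧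
    -- the output is correct whenever the answers of the oracle are
    (∀ O : Data → Data, AccurateFor B O → ∀ (P : A.Inst) (ε : ℝ), 0 < ε → ε < 1 →
      ∀ (y : Data) (t : ℕ) (Q : List Data), Run O alg (A.input P ε) y t Q →
        IsApprox y (A.count P) ε) ∧
    -- the algorithm halts in polynomial time, the reading of the answers included
    (∀ q : Polynomial ℕ, ∃ p : Polynomial ℕ, ∀ O : Data → Data, AnswersWithin q O →
      ∀ (P : A.Inst) (ε : ℝ), 0 < ε → ε < 1 →
        ∃ (y : Data) (t : ℕ) (Q : List Data), Run O alg (A.input P ε) y t Q ∧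
          t ≤ p.eval (A.parameter P ε))

/-! ## Counting constraint satisfaction problems -/

/-- Relations of arbitrary finite arity on `D`: an arity `n` and a set of `n`-tuples. -/
abbrev Rel (D : Type*) := Σ n : ℕ, Set (Fin n → D)

/-- A constraint with variables from `V` and a relation from `Γ`. -/
structure Constraint {D : Type*} (Γ : Set (Rel D)) (V : Type*) where
  rel : Rel D
  mem : rel ∈ Γ
  scope : Fin rel.1 → V

/-- An instance of the constraint satisfaction problem over `Γ` with the set of variables `V`,
given by the list of its constraints. -/
structure CSPInstance {D : Type*} (Γ : Set (Rel D)) (V : Type*) where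
  constraints : List (Constraint Γ V)

/-- `φ` is a solution: it maps every scope into the relation of its constraint. -/
def CSPInstance.IsSolution {D V : Type*} {Γ : Set (Rel D)} (P : CSPInstance Γ V)
    (φ : V → D) : Prop :=
  ∀ C ∈ P.constraints, (fun i => φ (C.scope i)) ∈ C.rel.2

/-- The number of ways to extend an assignment of the variables `Fin n` by an assignment of the
variables `Fin q` to a solution. -/
noncomputable def CSPInstance.extensions {D : Type*} {Γ : Set (Rel D)} {n q : ℕ}
    (P : CSPInstance Γ (Fin n ⊕ Fin q)) (φ : Fin n → D) : ℕ :=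
  Nat.card {ψ : Fin q → D // P.IsSolution (Sum.elim φ ψ)}

/-- `P` is a max-implementation of `R`: the tuples of `R` are exactly the assignments of the
first `n` variables whose number of extensions is maximal. -/
def CSPInstance.IsMaxImplementation {D : Type*} {Γ : Set (Rel D)} {n q : ℕ}
    (P : CSPInstance Γ (Fin n ⊕ Fin q)) (R : Set (Fin n → D)) : Prop :=
  ∀ φ : Fin n → D, φ ∈ R ↔ ∀ φ' : Fin n → D, P.extensions φ' ≤ P.extensions φ

/-- There is a max-implementation of `R` by `Γ`. -/
def HasMaxImplementation {D : Type*} (Γ : Set (Rel D)) {n : ℕ} (R : Set (Fin n → D)) : Prop :=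
  ∃ (q : ℕ) (P : CSPInstance Γ (Fin n ⊕ Fin q)), P.IsMaxImplementation R

/-- A fixed numbering of the countably many relations on a finite set, used as their names. Only
finitely many names occur in the problem over a finite `Γ`, so the choice is immaterial. -/
noncomputable def relName {D : Type*} [Finite D] : Rel D → ℕ :=
  (exists_injective_nat (Rel D)).choose

theorem relName_injective {D : Type*} [Finite D] : Function.Injective (relName (D := D)) :=
  (exists_injective_nat (Rel D)).choose_spec

/-- A constraint, written as the name of its relation and the list of variables in its scope. -/
noncomputable def Constraint.encode {D : Type*} [Finite D] {Γ : Set (Rel D)} {k : ℕ}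
    (C : Constraint Γ (Fin k)) : Data :=
  .pair (.num (relName C.rel)) (Data.ofNats (List.ofFn fun i => (C.scope i : ℕ)))

/-- The problem `#CSP(Γ)`. An instance with variables `0, …, k - 1` is written as the list of its
variables and the list of its constraints; the objective is the number of solutions. -/
noncomputable def NCSP {D : Type*} [Finite D] (Γ : Set (Rel D)) : CountingProblem where
  Inst := Σ k : ℕ, CSPInstance Γ (Fin k)
  encode P := .pair (Data.ofNats (List.range P.1))
    (Data.ofList (P.2.constraints.map Constraint.encode))
  count P := Nat.card {φ : Fin P.1 → D // P.2.IsSolution φ}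

end CountingCSP

namespace CountingCSP

/-! ## Polynomial-time computations -/

/-! Let `G` implement `R`, and let `M` be the maximal number of extensions. Replace every
`R`-constraint by a copy of `G` on fresh variables and repeat the whole constraint list `M * L`
times, with new fresh variables each time. A solution of the given instance then extends in exactly
`norm` ways, where `norm` is a power of `M`. A non-solution violates some constraint, which costs a
factor `(M - 1) / M` or worse in each repetition; as `((M - 1) / M) ^ M ≤ 1 / 2`, it extends in at
most `norm / 2 ^ L` ways. With `2 ^ L > 4 * E * |D| ^ k` and `E = ⌈1 / ε⌉`, all non-solutions
together contribute at most `norm / (4 * E)`. These estimates are `IsGadget.prod_of_not_sat` and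
`IsGadget.card_bounds`.

One oracle call with error `1 / (4 * E)`, divided by `norm`, therefore approximates the count. Since
zero must be reported exactly, quotients below `1 / 2` are replaced by `0` (`isApprox_readOff`).

Polynomial time is handled by `PolyTime`, whose closure rules assemble programs from a specification
of input and output. Loops require bounds on all intermediate states; these come from
`Stage.Bounded`, and `polyTime_reduced` collects the result. `apReducible_of_polyTime` turns it into
a reduction. -/

/-- `g` is bounded by a polynomial in the parameter `w`. -/
def PolyBdd {α : Type*} (w g : α → ℕ) : Prop :=
  ∃ T : Polynomial ℕ, ∀ a, g a ≤ T.eval (w a)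

theorem eval_mono (T : Polynomial ℕ) : Monotone fun n : ℕ => T.eval n := by
  intro a b h
  induction T using Polynomial.induction_on' with
  | add p q hp hq => simp only [Polynomial.eval_add] at *; exact Nat.add_le_add hp hq
  | monomial n c =>
    simp only [Polynomial.eval_monomial]
    exact Nat.mul_le_mul_left _ (Nat.pow_le_pow_left h _)

namespace PolyBdd

variable {α β : Type*} {w g h : α → ℕ}

theorem mono (hh : PolyBdd w h) (H : ∀ a, g a ≤ h a) : PolyBdd w g :=
  hh.imp fun _ hT a => (H a).trans (hT a)

theorem const (w : α → ℕ) (n : ℕ) : PolyBdd w fun _ => n :=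
  ⟨Polynomial.C n, fun a => by simp⟩

theorem self (w : α → ℕ) : PolyBdd w w := ⟨Polynomial.X, fun a => by simp⟩

theorem add (hg : PolyBdd w g) (hh : PolyBdd w h) : PolyBdd w fun a => g a + h a := by
  obtain ⟨S, hS⟩ := hg
  obtain ⟨T, hT⟩ := hh
  exact ⟨S + T, fun a => by rw [Polynomial.eval_add]; exact Nat.add_le_add (hS a) (hT a)⟩

theorem mul (hg : PolyBdd w g) (hh : PolyBdd w h) : PolyBdd w fun a => g a * h a := by
  obtain ⟨S, hS⟩ := hg
  obtain ⟨T, hT⟩ := hh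
  exact ⟨S * T, fun a => by rw [Polynomial.eval_mul]; exact Nat.mul_le_mul (hS a) (hT a)⟩

theorem comap (hg : PolyBdd w g) (f : β → α) : PolyBdd (fun b => w (f b)) fun b => g (f b) :=
  hg.imp fun _ hT b => hT (f b)

end PolyBdd

/-- Some program computes `f a` from `e a`, without oracle calls, in time polynomial in `w a`. -/
def PolyTime {α : Type*} (w : α → ℕ) (e f : α → Data) : Prop :=
  ∃ p : Prog, ∃ T : Polynomial ℕ, ∀ (O : Data → Data) (a : α),
    ∃ t ≤ T.eval (w a), Run O p (e a) (f a) t []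

/-- A program has the time to read its input and to write its output. -/
theorem Run.size_le {O : Data → Data} {p : Prog} {x y : Data} {t : ℕ} {Q : List Data}
    (h : Run O p x y t Q) : x.size ≤ t ∧ y.size ≤ t := by
  induction h <;> (try simp only [Data.size]) <;> omega

/-! ### Growth of binary lengths under the elementary operations -/

theorem size_mul_le_add (a b : ℕ) : Nat.size (a * b) ≤ Nat.size a + Nat.size b := by
  rw [Nat.size_le, pow_add]
  exact Nat.mul_lt_mul'' (Nat.lt_size_self a) (Nat.lt_size_self b)

theorem size_add_le_add (a b : ℕ) : Nat.size (a + b) ≤ Nat.size a + Nat.size b + 1 := by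
  rw [Nat.size_le]
  have ha := Nat.lt_size_self a
  have hb := Nat.lt_size_self b
  have h1 : 2 ^ a.size ≤ 2 ^ (a.size + b.size) := Nat.pow_le_pow_right (by norm_num) (by omega)
  have h2 : 2 ^ b.size ≤ 2 ^ (a.size + b.size) := Nat.pow_le_pow_right (by norm_num) (by omega)
  rw [pow_succ]
  omega

theorem size_le_self (n : ℕ) : Nat.size n ≤ n := by
  rw [Nat.size_le]; exact Nat.lt_two_pow_self

theorem Op.size_eval_le (o : Op) : ∃ c : ℕ, ∀ x : Data, (o.eval x).size ≤ x.size + c := by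
  cases o with
  | const n => exact ⟨n.size + 1, fun x => by simp [Op.eval, Data.size]⟩
  | _ =>
    refine ⟨2, fun x => ?_⟩
    rcases x with n | ⟨a | ⟨a₁, a₂⟩, b | ⟨b₁, b₂⟩⟩ <;>
      simp only [Op.eval, Data.size, Nat.size_zero, Nat.size_one] <;> try omega
    all_goals
      have h1 := size_add_le_add a b
      have h2 := size_mul_le_add a b
      have h3 := Nat.size_le_size (Nat.sub_le a b)
      have h4 := Nat.size_le_size (Nat.div_le_self a b)
      omega

namespace PolyTime

variable {α β : Type*} {w : α → ℕ} {e f g h : α → Data}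

/-- Running time includes reading the input, so a time bound is also a length bound. This and
`size_right` spare later constructions separate hypotheses on sizes. -/
theorem size_left (H : PolyTime w e f) : PolyBdd w fun a => (e a).size := by
  obtain ⟨p, T, hT⟩ := H
  refine ⟨T, fun a => ?_⟩
  obtain ⟨t, ht, hr⟩ := hT id a
  exact hr.size_le.1.trans ht

theorem size_right (H : PolyTime w e f) : PolyBdd w fun a => (f a).size := by
  obtain ⟨p, T, hT⟩ := H
  refine ⟨T, fun a => ?_⟩
  obtain ⟨t, ht, hr⟩ := hT id a
  exact hr.size_le.2.trans ht

theorem congr (H : PolyTime w e f) (hfg : ∀ a, f a = g a) : PolyTime w e g := by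
  obtain rfl : f = g := funext hfg
  exact H

theorem congr_left {e' : α → Data} (H : PolyTime w e f) (he : ∀ a, e a = e' a) :
    PolyTime w e' f := by
  obtain rfl : e = e' := funext he
  exact H

theorem of_op (o : Op) (he : PolyBdd w fun a => (e a).size) :
    PolyTime w e fun a => o.eval (e a) := by
  obtain ⟨c, hc⟩ := o.size_eval_le
  obtain ⟨T, hT⟩ := he.add (he.add (PolyBdd.const w c))
  exact ⟨.op o, T, fun O a => ⟨_, (Nat.add_le_add_left (hc _) _).trans (hT a), Run.op o _⟩⟩

theorem refl (he : PolyBdd w fun a => (e a).size) : PolyTime w e e := of_op .id he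

theorem trans (hf : PolyTime w e f) (hg : PolyTime w f g) : PolyTime w e g := by
  obtain ⟨p, S, hS⟩ := hf
  obtain ⟨q, T, hT⟩ := hg
  refine ⟨.seq p q, S + T + 1, fun O a => ?_⟩
  obtain ⟨s, hs, hr⟩ := hS O a
  obtain ⟨t, ht, hr'⟩ := hT O a
  refine ⟨_, ?_, Run.seq hr hr'⟩
  simp only [Polynomial.eval_add, Polynomial.eval_one]
  omega

theorem pair (hf : PolyTime w e f) (hg : PolyTime w e g) :
    PolyTime w e fun a => .pair (f a) (g a) := by
  obtain ⟨p, S, hS⟩ := hf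
  obtain ⟨q, T, hT⟩ := hg
  refine ⟨.fork p q, S + T + 1, fun O a => ?_⟩
  obtain ⟨s, hs, hr⟩ := hS O a
  obtain ⟨t, ht, hr'⟩ := hT O a
  refine ⟨_, ?_, Run.fork hr hr'⟩
  simp only [Polynomial.eval_add, Polynomial.eval_one]
  omega

theorem comap (H : PolyTime w e f) (u : β → α) :
    PolyTime (fun b => w (u b)) (fun b => e (u b)) fun b => f (u b) := by
  obtain ⟨p, T, hT⟩ := H
  exact ⟨p, T, fun O b => hT O (u b)⟩

/-- Polynomials compose: a subroutine timed in the length of its own input can be timed in the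
parameter of the surrounding computation once that length is known to be bounded. -/
theorem weight {v : α → ℕ} (H : PolyTime w e f) (hw : PolyBdd v w) : PolyTime v e f := by
  obtain ⟨p, T, hT⟩ := H
  obtain ⟨S, hS⟩ := hw
  refine ⟨p, T.comp S, fun O a => ?_⟩
  obtain ⟨t, ht, hr⟩ := hT O a
  refine ⟨t, ht.trans ?_, hr⟩
  rw [Polynomial.eval_comp]
  exact eval_mono T (hS a)

theorem op (o : Op) (hf : PolyTime w e f) : PolyTime w e fun a => o.eval (f a) :=
  hf.trans (of_op o hf.size_right)

theorem fst (H : PolyTime w e fun a => .pair (f a) (g a)) : PolyTime w e f := H.op .fst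

theorem snd (H : PolyTime w e fun a => .pair (f a) (g a)) : PolyTime w e g := H.op .snd

theorem const (he : PolyBdd w fun a => (e a).size) (n : ℕ) : PolyTime w e fun _ => .num n :=
  of_op (.const n) he

section Arithmetic

variable {m n : α → ℕ}

theorem add (hm : PolyTime w e fun a => .num (m a)) (hn : PolyTime w e fun a => .num (n a)) :
    PolyTime w e fun a => .num (m a + n a) := (hm.pair hn).op .add

theorem sub (hm : PolyTime w e fun a => .num (m a)) (hn : PolyTime w e fun a => .num (n a)) :
    PolyTime w e fun a => .num (m a - n a) := (hm.pair hn).op .sub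

theorem mul (hm : PolyTime w e fun a => .num (m a)) (hn : PolyTime w e fun a => .num (n a)) :
    PolyTime w e fun a => .num (m a * n a) := (hm.pair hn).op .mul

theorem div (hm : PolyTime w e fun a => .num (m a)) (hn : PolyTime w e fun a => .num (n a)) :
    PolyTime w e fun a => .num (m a / n a) := (hm.pair hn).op .div

end Arithmetic

/-- Branching. -/
theorem ite (hf : PolyTime w e f)
    (hg : PolyTime (fun a : {a // f a ≠ .num 0} => w a) (fun a => e a) fun a => g a)
    (hh : PolyTime (fun a : {a // f a = .num 0} => w a) (fun a => e a) fun a => g a) :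
    PolyTime w e g := by
  obtain ⟨c, S, hS⟩ := hf
  obtain ⟨p, T, hT⟩ := hg
  obtain ⟨q, U, hU⟩ := hh
  refine ⟨.ite c p q, S + T + U + 1, fun O a => ?_⟩
  simp only [Polynomial.eval_add, Polynomial.eval_one]
  obtain ⟨s, hs, hr⟩ := hS O a
  by_cases h0 : f a = .num 0
  · obtain ⟨t, ht, hr'⟩ := hU O ⟨a, h0⟩
    rw [h0] at hr
    exact ⟨_, by simp only at ht; omega, Run.ite_false hr hr'⟩
  · obtain ⟨t, ht, hr'⟩ := hT O ⟨a, h0⟩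
    exact ⟨_, by simp only at ht; omega, Run.ite_true hr h0 hr'⟩

/-- A loop that runs through the states `st a 0, …, st a (N a)`. -/
theorem loop {st test : α → ℕ → Data} {N : α → ℕ} (hN : PolyBdd w N)
    (hinit : PolyTime w e fun a => st a 0)
    (htest : PolyTime (fun x : {x : α × ℕ // x.2 ≤ N x.1} => w x.1.1)
      (fun x => st x.1.1 x.1.2) fun x => test x.1.1 x.1.2)
    (htrue : ∀ a, ∀ i < N a, test a i ≠ .num 0) (hfalse : ∀ a, test a (N a) = .num 0)
    (hstep : PolyTime (fun x : {x : α × ℕ // x.2 < N x.1} => w x.1.1)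
      (fun x => st x.1.1 x.1.2) fun x => st x.1.1 (x.1.2 + 1)) :
    PolyTime w e fun a => st a (N a) := by
  refine hinit.trans ?_
  obtain ⟨c, S, hS⟩ := htest
  obtain ⟨p, T, hT⟩ := hstep
  obtain ⟨B, hB⟩ := hN
  refine ⟨.loop c p, B * (S + T + 1) + S + 1, fun O a => ?_⟩
  -- Induction on the number `j` of iterations still to run, because `Run.loop_true` peels off the
  -- first iteration. The extra `S + 1` pays for the final failing test.
  have key : ∀ j ≤ N a, ∃ t ≤ j * ((S + T + 1).eval (w a)) + S.eval (w a) + 1,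
      Run O (.loop c p) (st a (N a - j)) (st a (N a)) t [] := by
    intro j
    induction j with
    | zero =>
      intro _
      obtain ⟨s, hs, hr⟩ := hS O ⟨(a, N a), le_rfl⟩
      simp only [hfalse] at hr
      exact ⟨s + 1, by simp only at hs; omega, Run.loop_false hr⟩
    | succ j ih =>
      intro hj
      obtain ⟨u, hu, hr''⟩ := ih (by omega)
      obtain ⟨s, hs, hr⟩ := hS O ⟨(a, N a - (j + 1)), Nat.sub_le _ _⟩
      obtain ⟨t, ht, hr'⟩ := hT O ⟨(a, N a - (j + 1)), by dsimp only; omega⟩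
      simp only at hs ht hr hr'
      rw [show N a - (j + 1) + 1 = N a - j by omega] at hr'
      refine ⟨_, ?_, Run.loop_true hr (htrue a _ (by omega)) hr' hr''⟩
      simp only [Polynomial.eval_add, Polynomial.eval_one] at hu ⊢
      rw [Nat.succ_mul]
      omega
  obtain ⟨t, ht, hr⟩ := key (N a) le_rfl
  rw [Nat.sub_self] at hr
  refine ⟨t, ht.trans ?_, hr⟩
  simp only [Polynomial.eval_add, Polynomial.eval_mul, Polynomial.eval_one]
  gcongr
  exact hB a

/-- Prepending a fixed number of computed entries to a list. -/
theorem prepend (fs : List (α → Data)) (hfs : ∀ u ∈ fs, PolyTime w e u) {l : α → List Data}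
    (hl : PolyTime w e fun a => .ofList (l a)) :
    PolyTime w e fun a => .ofList (fs.map (fun u => u a) ++ l a) := by
  induction fs with
  | nil => exact hl
  | cons u fs ih =>
    exact (hfs u (by simp)).pair (ih fun v hv => hfs v (by simp [hv]))

/-- An entry at a fixed position of a list. -/
theorem getElem {n : ℕ} {x : α → Fin n → Data}
    (hx : PolyTime w e fun a => .ofList (List.ofFn (x a))) (i : Fin n) :
    PolyTime w e fun a => x a i := by
  induction n with
  | zero => exact i.elim0
  | succ n ih =>
    simp only [List.ofFn_succ, Data.ofList] at hx
    refine Fin.cases hx.fst (fun j => ?_) i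
    exact ih hx.snd j

end PolyTime

/-! ### Lists and iteration over them -/

namespace Data

theorem length_le_size_ofList (l : List Data) : l.length ≤ (ofList l).size := by
  induction l with
  | nil => simp
  | cons a l ih => simp only [List.length_cons, ofList, size]; omega

theorem size_ofList_drop_le (l : List Data) (i : ℕ) :
    (ofList (l.drop i)).size ≤ (ofList l).size := by
  induction l generalizing i with
  | nil => simp
  | cons a l ih =>
    cases i with
    | zero => simp
    | succ i =>
      have := ih i
      simp only [List.drop_succ_cons, ofList, size]; omega

theorem size_ofList_le {l : List Data} {B : ℕ} (h : ∀ a ∈ l, a.size ≤ B) :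
    (ofList l).size ≤ l.length * (B + 1) + 1 := by
  induction l with
  | nil => simp [ofList, size]
  | cons a l ih =>
    have h1 := ih fun b hb => h b (by simp [hb])
    have h2 := h a (by simp)
    simp only [ofList, size, List.length_cons, Nat.succ_mul]
    omega

theorem size_le_size_ofList {l : List Data} {a : Data} (h : a ∈ l) : a.size ≤ (ofList l).size := by
  induction l with
  | nil => simp at h
  | cons b l ih =>
    simp only [ofList, size]
    rcases List.mem_cons.1 h with rfl | h
    · omega
    · have := ih h; omega

end Data

/-- Iteration over a list. -/
theorem PolyTime.fold {α : Type*} {w : α → ℕ} {e : α → Data} {l : α → List Data}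
    {st : α → ℕ → Data} (hl : PolyTime w e fun a => .ofList (l a))
    (hinit : PolyTime w e fun a => st a 0)
    (hst : PolyBdd (fun x : {x : α × ℕ // x.2 ≤ (l x.1).length} => w x.1.1)
      fun x => (st x.1.1 x.1.2).size)
    (hstep : PolyTime (fun x : {x : α × ℕ // x.2 < (l x.1).length} => w x.1.1)
      (fun x => .pair (st x.1.1 x.1.2) ((l x.1.1)[x.1.2]'x.2)) fun x => st x.1.1 (x.1.2 + 1)) :
    PolyTime w e fun a => st a (l a).length := by
  have hlen : PolyBdd w fun a => (l a).length :=
    hl.size_right.mono fun a => Data.length_le_size_ofList _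
  have hsize : PolyBdd (fun x : {x : α × ℕ // x.2 ≤ (l x.1).length} => w x.1.1)
      fun x => (Data.pair (st x.1.1 x.1.2) (.ofList ((l x.1.1).drop x.1.2))).size := by
    refine ((hst.add (hl.size_right.comap fun x : {x : α × ℕ // x.2 ≤ (l x.1).length} =>
      x.1.1)).add (.const _ 1)).mono fun x => ?_
    have := Data.size_ofList_drop_le (l x.1.1) x.1.2
    simp only [Data.size]
    omega
  -- The state carries the unread rest of the list. A nonempty rest is a pair and the empty one is
  -- `0`, so `isPair` serves as the loop test.
  refine (PolyTime.loop (st := fun a i => .pair (st a i) (.ofList ((l a).drop i)))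
    (test := fun a i => Op.isPair.eval (.ofList ((l a).drop i))) hlen (hinit.pair hl)
    ((PolyTime.refl hsize).snd.op .isPair) ?_ ?_ ?_).fst
  · intro a i hi
    rw [List.drop_eq_getElem_cons hi]
    simp [Data.ofList, Op.eval]
  · intro a
    simp [Data.ofList, Op.eval]
  · have h0 : PolyTime (fun x : {x : α × ℕ // x.2 < (l x.1).length} => w x.1.1)
        (fun x => Data.pair (st x.1.1 x.1.2) (.ofList ((l x.1.1).drop x.1.2)))
        (fun x => Data.pair (st x.1.1 x.1.2)
          (.pair ((l x.1.1)[x.1.2]'x.2) (.ofList ((l x.1.1).drop (x.1.2 + 1))))) := by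
      refine (PolyTime.refl (hsize.comap fun x : {x : α × ℕ // x.2 < (l x.1).length} =>
        ⟨x.1, x.2.le⟩)).congr fun x => ?_
      rw [List.drop_eq_getElem_cons x.2, Data.ofList]
    exact ((h0.fst.pair h0.snd.fst).trans hstep).pair h0.snd.snd

/-! ### The inequality `((M - 1) / M) ^ M ≤ 1 / 2` -/

/-- These are the first two terms of the binomial expansion (Bernoulli's inequality). -/
theorem pow_add_mul_pow_le_succ_pow (m j : ℕ) :
    m ^ (j + 1) + (j + 1) * m ^ j ≤ (m + 1) ^ (j + 1) := by
  induction j with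
  | zero => simp
  | succ j ih =>
    calc m ^ (j + 2) + (j + 1 + 1) * m ^ (j + 1)
        ≤ (m ^ (j + 1) + (j + 1) * m ^ j) * (m + 1) := by
          rw [pow_succ m (j + 1), pow_succ m j]; nlinarith [Nat.zero_le ((j + 1) * m ^ j)]
      _ ≤ (m + 1) ^ (j + 1) * (m + 1) := Nat.mul_le_mul_right _ ih

/-- With `M = m + 1`, the two leading binomial terms of `(m + 1) ^ (m + 1)` sum to `(2 * m + 1) * m
^ m`, which is at least `2 * m ^ (m + 1)`. -/
theorem sub_one_pow_mul_two_le {M : ℕ} (hM : 0 < M) : (M - 1) ^ M * 2 ≤ M ^ M := by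
  obtain ⟨m, rfl⟩ := Nat.exists_eq_add_of_lt hM
  simp only [zero_add, Nat.add_sub_cancel]
  have := pow_add_mul_pow_le_succ_pow m m
  rw [pow_succ m] at this ⊢
  nlinarith [Nat.zero_le (m ^ m)]

/-! ## Counting the solutions of the new instance -/

section Stages

variable {D : Type*} {Γ : Set (Rel D)}

/-- Renaming the variables of a constraint. -/
def Constraint.map {V W : Type*} (f : V → W) (C : Constraint Γ V) : Constraint Γ W :=
  ⟨C.rel, C.mem, f ∘ C.scope⟩

/-- `φ` satisfies the constraint `C`. -/
def Constraint.Sat {V : Type*} (C : Constraint Γ V) (φ : V → D) : Prop :=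
  (fun i => φ (C.scope i)) ∈ C.rel.2

/-- An instance over `Γ` whose first `k` variables are those of a given instance, together with
a factor by which its number of solutions is to be divided. -/
structure Stage (Γ : Set (Rel D)) (k : ℕ) where
  size : ℕ
  le : k ≤ size
  cons : List (Constraint Γ (Fin size))
  norm : ℕ

/-- The number of solutions that extend `φ`. -/
noncomputable def Stage.count {k : ℕ} (S : Stage Γ k) (φ : Fin k → D) : ℕ :=
  Nat.card {ψ : Fin S.size → D // (∀ C ∈ S.cons, C.Sat ψ) ∧ ψ ∘ Fin.castLE S.le = φ}

/-- The stage without constraints. -/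
def Stage.init (Γ : Set (Rel D)) (k : ℕ) : Stage Γ k := ⟨k, le_rfl, [], 1⟩

theorem Stage.count_init {k : ℕ} (φ : Fin k → D) : (Stage.init Γ k).count φ = 1 := by
  have : Unique {ψ : Fin (Stage.init Γ k).size → D //
      (∀ C ∈ (Stage.init Γ k).cons, C.Sat ψ) ∧ ψ ∘ Fin.castLE (Stage.init Γ k).le = φ} :=
    { default := ⟨φ, fun _ hC => absurd hC List.not_mem_nil, rfl⟩
      uniq := fun ψ => Subtype.ext ψ.2.2 }
  exact Nat.card_unique

/-- Partition the solutions by their restriction to the original `k` variables. -/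
theorem Stage.sum_count [Fintype D] {k : ℕ} (S : Stage Γ k) :
    Nat.card {ψ : Fin S.size → D // (⟨S.cons⟩ : CSPInstance Γ (Fin S.size)).IsSolution ψ} =
      ∑ φ : Fin k → D, S.count φ := by
  rw [← Nat.card_congr (Equiv.sigmaFiberEquiv fun ψ : {ψ : Fin S.size → D //
    (⟨S.cons⟩ : CSPInstance Γ (Fin S.size)).IsSolution ψ} => ψ.1 ∘ Fin.castLE S.le),
    Nat.card_sigma]
  exact Finset.sum_congr rfl fun φ _ =>
    Nat.card_congr (Equiv.subtypeSubtypeEquivSubtypeInter _ fun ψ => ψ ∘ Fin.castLE S.le = φ)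

variable {n q : ℕ} {R : Set (Fin n → D)} (G : CSPInstance Γ (Fin n ⊕ Fin q)) (M : ℕ)

/-- The scope of a constraint whose relation is `R`. -/
def Constraint.scopeOf {Γ : Set (Rel D)} {V : Type*} (C : Constraint Γ V)
    (h : C.rel = ⟨n, R⟩) : Fin n → V :=
  fun i => C.scope (Fin.cast (congrArg Sigma.fst h).symm i)

/-- Adding a copy of `G` on fresh variables, applied to the variables `s`. -/
def Stage.addGadget {k : ℕ} (S : Stage Γ k) (s : Fin n → Fin k) : Stage Γ k where
  size := S.size + q
  le := S.le.trans (Nat.le_add_right _ _)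
  cons := G.constraints.map (Constraint.map (Sum.elim
      (fun i => Fin.castAdd q (Fin.castLE S.le (s i))) (Fin.natAdd S.size))) ++
    S.cons.map (Constraint.map (Fin.castAdd q))
  norm := S.norm * M

theorem Stage.forall_mem_addGadget {k : ℕ} (S : Stage Γ k) (s : Fin n → Fin k)
    (ψ : Fin (S.size + q) → D) :
    (∀ C ∈ (S.addGadget G M s).cons, C.Sat ψ) ↔
      G.IsSolution (ψ ∘ Sum.elim (fun i => Fin.castAdd q (Fin.castLE S.le (s i)))
        (Fin.natAdd S.size)) ∧ ∀ C ∈ S.cons, C.Sat (ψ ∘ Fin.castAdd q) :=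
  List.forall_mem_append.trans (and_congr List.forall_mem_map List.forall_mem_map)

/-- The fresh variables occur only in the new copy of `G`, which meets the old ones only in `s`.
Once `φ` is fixed, the old part and the fresh part of an assignment are chosen independently, and
`Fin.append` glues them. -/
theorem Stage.count_addGadget {k : ℕ} (S : Stage Γ k) (s : Fin n → Fin k) (φ : Fin k → D) :
    (S.addGadget G M s).count φ = S.count φ * G.extensions (φ ∘ s) := by
  rw [Stage.count, Stage.count, CSPInstance.extensions, ← Nat.card_prod]
  have key : ∀ ψ : Fin (S.size + q) → D,
      ((∀ C ∈ (S.addGadget G M s).cons, C.Sat ψ) ∧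
        ψ ∘ Fin.castLE (S.addGadget G M s).le = φ) ↔
      (((∀ C ∈ S.cons, C.Sat (ψ ∘ Fin.castAdd q)) ∧
        (ψ ∘ Fin.castAdd q) ∘ Fin.castLE S.le = φ) ∧
        G.IsSolution (Sum.elim (φ ∘ s) (ψ ∘ Fin.natAdd S.size))) := by
    intro ψ
    have h1 : ψ ∘ Fin.castLE (S.addGadget G M s).le = (ψ ∘ Fin.castAdd q) ∘ Fin.castLE S.le := rfl
    rw [h1, S.forall_mem_addGadget]
    have h2 : ∀ hφ : (ψ ∘ Fin.castAdd q) ∘ Fin.castLE S.le = φ,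
        Sum.elim (φ ∘ s) (ψ ∘ Fin.natAdd S.size) = ψ ∘ (Sum.elim
          (fun i => Fin.castAdd q (Fin.castLE S.le (s i))) (Fin.natAdd S.size)) := by
      rintro rfl
      ext (i | i) <;> rfl
    constructor
    · rintro ⟨⟨hG, hs⟩, hφ⟩
      exact ⟨⟨hs, hφ⟩, (h2 hφ).symm ▸ hG⟩
    · rintro ⟨⟨hs, hφ⟩, hG⟩
      exact ⟨⟨h2 hφ ▸ hG, hs⟩, hφ⟩
  refine Nat.card_congr
    { toFun := fun ψ => (⟨ψ.1 ∘ Fin.castAdd q, ((key ψ.1).1 ψ.2).1⟩,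
        ⟨ψ.1 ∘ Fin.natAdd S.size, ((key ψ.1).1 ψ.2).2⟩)
      invFun := fun x => ⟨Fin.append x.1.1 x.2.1, (key _).2 ?_⟩
      left_inv := fun ψ => Subtype.ext (Fin.append_castAdd_natAdd (f := ψ.1))
      right_inv := fun x => ?_ }
  · have h1 : Fin.append x.1.1 x.2.1 ∘ Fin.castAdd q = x.1.1 :=
      funext fun i => Fin.append_left _ _ i
    have h2 : Fin.append x.1.1 x.2.1 ∘ Fin.natAdd S.size = x.2.1 :=
      funext fun i => Fin.append_right _ _ i
    rw [h1, h2]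
    exact ⟨x.1.2, x.2.2⟩
  · refine Prod.ext (Subtype.ext ?_) (Subtype.ext ?_)
    · exact funext fun i => Fin.append_left _ _ i
    · exact funext fun i => Fin.append_right _ _ i

/-- Adding a constraint over `Γ`. -/
def Stage.addConstraint {k : ℕ} (S : Stage Γ k) (C : Constraint Γ (Fin k)) : Stage Γ k where
  size := S.size
  le := S.le
  cons := C.map (Fin.castLE S.le) :: S.cons
  norm := S.norm

open Classical in
theorem Stage.count_addConstraint {k : ℕ} (S : Stage Γ k) (C : Constraint Γ (Fin k))
    (φ : Fin k → D) : (S.addConstraint C).count φ = S.count φ * if C.Sat φ then 1 else 0 := by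
  have key : ∀ ψ : Fin S.size → D, ψ ∘ Fin.castLE S.le = φ →
      ((∀ C' ∈ (S.addConstraint C).cons, C'.Sat ψ) ↔ (∀ C' ∈ S.cons, C'.Sat ψ) ∧ C.Sat φ) := by
    rintro ψ rfl
    exact List.forall_mem_cons.trans and_comm
  split_ifs with h
  · rw [mul_one]
    refine Nat.card_congr (Equiv.subtypeEquivRight fun ψ => and_congr_left fun hφ => ?_)
    rw [key ψ hφ, and_iff_left h]
  · rw [mul_zero]
    have : IsEmpty {ψ : Fin (S.addConstraint C).size → D //
        (∀ C' ∈ (S.addConstraint C).cons, C'.Sat ψ) ∧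
          ψ ∘ Fin.castLE (S.addConstraint C).le = φ} :=
      ⟨fun ψ => h ((key ψ.1 ψ.2.2).1 ψ.2.1).2⟩
    exact Nat.card_of_isEmpty

/-- A constraint over `Γ ∪ {R}` whose relation is not `R`, as a constraint over `Γ`. -/
def Constraint.restrict {V : Type*} (C : Constraint (Γ ∪ {⟨n, R⟩}) V)
    (h : C.rel ≠ ⟨n, R⟩) : Constraint Γ V :=
  ⟨C.rel, C.mem.resolve_right h, C.scope⟩

open Classical in
/-- Adding a constraint over `Γ ∪ {R}`, with `R` replaced by `G`. -/
noncomputable def Stage.step {k : ℕ} (S : Stage Γ k)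
    (C : Constraint (Γ ∪ {⟨n, R⟩}) (Fin k)) : Stage Γ k :=
  if h : C.rel = ⟨n, R⟩ then S.addGadget G M (C.scopeOf h) else S.addConstraint (C.restrict h)

open Classical in
/-- The factor that a constraint contributes to the number of extensions of `φ`. -/
noncomputable def factor {k : ℕ} (φ : Fin k → D) (C : Constraint (Γ ∪ {⟨n, R⟩}) (Fin k)) : ℕ :=
  if h : C.rel = ⟨n, R⟩ then G.extensions (φ ∘ C.scopeOf h) else if C.Sat φ then 1 else 0

open Classical in
/-- The factor that a constraint contributes if it is satisfied. -/
noncomputable def topFactor {k : ℕ} (C : Constraint (Γ ∪ {⟨n, R⟩}) (Fin k)) : ℕ :=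
  if C.rel = ⟨n, R⟩ then M else 1

theorem Stage.count_step {k : ℕ} (S : Stage Γ k) (C : Constraint (Γ ∪ {⟨n, R⟩}) (Fin k))
    (φ : Fin k → D) : (S.step G M C).count φ = S.count φ * factor G φ C := by
  by_cases h : C.rel = ⟨n, R⟩
  · rw [Stage.step, factor, dif_pos h, dif_pos h, Stage.count_addGadget]
  · rw [Stage.step, factor, dif_neg h, dif_neg h, Stage.count_addConstraint]
    rfl

theorem Stage.norm_step {k : ℕ} (S : Stage Γ k) (C : Constraint (Γ ∪ {⟨n, R⟩}) (Fin k)) :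
    (S.step G M C).norm = S.norm * topFactor M C := by
  by_cases h : C.rel = ⟨n, R⟩
  · rw [Stage.step, topFactor, dif_pos h, if_pos h]; rfl
  · rw [Stage.step, topFactor, dif_neg h, if_neg h, mul_one]; rfl

/-- Adding the constraints of a list. -/
noncomputable def Stage.round {k : ℕ} (l : List (Constraint (Γ ∪ {⟨n, R⟩}) (Fin k)))
    (S : Stage Γ k) : Stage Γ k := l.foldl (Stage.step G M) S

theorem Stage.count_round {k : ℕ} (l : List (Constraint (Γ ∪ {⟨n, R⟩}) (Fin k)))
    (S : Stage Γ k) (φ : Fin k → D) :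
    (S.round G M l).count φ = S.count φ * (l.map (factor G φ)).prod := by
  induction l generalizing S with
  | nil => simp [Stage.round]
  | cons C l ih =>
    have := ih (S.step G M C)
    rw [Stage.count_step] at this
    rw [List.map_cons, List.prod_cons, ← mul_assoc]
    exact this

theorem Stage.norm_round {k : ℕ} (l : List (Constraint (Γ ∪ {⟨n, R⟩}) (Fin k)))
    (S : Stage Γ k) : (S.round G M l).norm = S.norm * (l.map (topFactor M)).prod := by
  induction l generalizing S with
  | nil => simp [Stage.round]
  | cons C l ih =>
    have := ih (S.step G M C)
    rw [Stage.norm_step] at this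
    rw [List.map_cons, List.prod_cons, ← mul_assoc]
    exact this

/-- Adding the constraints of a list `m` times. -/
noncomputable def Stage.rounds {k : ℕ} (l : List (Constraint (Γ ∪ {⟨n, R⟩}) (Fin k)))
    (m : ℕ) : Stage Γ k := (Stage.round G M l)^[m] (Stage.init Γ k)

theorem Stage.rounds_succ {k : ℕ} (l : List (Constraint (Γ ∪ {⟨n, R⟩}) (Fin k))) (m : ℕ) :
    Stage.rounds G M l (m + 1) = (Stage.rounds G M l m).round G M l :=
  Function.iterate_succ_apply' _ _ _

theorem Stage.count_rounds {k : ℕ} (l : List (Constraint (Γ ∪ {⟨n, R⟩}) (Fin k)))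
    (m : ℕ) (φ : Fin k → D) :
    (Stage.rounds G M l m).count φ = (l.map (factor G φ)).prod ^ m := by
  induction m with
  | zero => exact Stage.count_init φ
  | succ m ih => rw [Stage.rounds_succ, Stage.count_round, ih, pow_succ]

theorem Stage.norm_rounds {k : ℕ} (l : List (Constraint (Γ ∪ {⟨n, R⟩}) (Fin k))) (m : ℕ) :
    (Stage.rounds G M l m).norm = (l.map (topFactor M)).prod ^ m := by
  induction m with
  | zero => rfl
  | succ m ih => rw [Stage.rounds_succ, Stage.norm_round, ih, pow_succ]

/-! ### The gap between solutions and non-solutions -/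

/-- The tuples of `R` have exactly `M ≥ 1` extensions to solutions of `G`, the others fewer. -/
structure IsGadget (R : Set (Fin n → D)) : Prop where
  pos : 0 < M
  eq_of_mem : ∀ φ ∈ R, G.extensions φ = M
  lt_of_notMem : ∀ φ ∉ R, G.extensions φ < M

variable {G M}

theorem Constraint.sat_iff_scopeOf {Γ : Set (Rel D)} {V : Type*} (C : Constraint Γ V)
    (h : C.rel = ⟨n, R⟩) (φ : V → D) : C.Sat φ ↔ φ ∘ C.scopeOf h ∈ R := by
  obtain ⟨rel, mem, scope⟩ := C
  dsimp only at h
  subst h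
  rfl

namespace IsGadget

variable (H : IsGadget G M R)

include H

theorem factor_of_sat {k : ℕ} {φ : Fin k → D} {C : Constraint (Γ ∪ {⟨n, R⟩}) (Fin k)}
    (h : C.Sat φ) : factor G φ C = topFactor M C := by
  by_cases hC : C.rel = ⟨n, R⟩
  · rw [factor, topFactor, dif_pos hC, if_pos hC]
    exact H.eq_of_mem _ ((C.sat_iff_scopeOf hC φ).1 h)
  · rw [factor, topFactor, dif_neg hC, if_neg hC, if_pos h]

/-- For `R` the number of extensions is an integer below `M`, hence at most `M - 1`; a violated
constraint over `Γ` contributes `0`. Multiplying by `M` keeps the ratio `(M - 1) / M` inside `ℕ`. -/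
theorem factor_of_not_sat {k : ℕ} {φ : Fin k → D} {C : Constraint (Γ ∪ {⟨n, R⟩}) (Fin k)}
    (h : ¬ C.Sat φ) : factor G φ C * M ≤ (M - 1) * topFactor M C := by
  by_cases hC : C.rel = ⟨n, R⟩
  · rw [factor, topFactor, dif_pos hC, if_pos hC]
    have := H.lt_of_notMem _ (mt (C.sat_iff_scopeOf hC φ).2 h)
    exact Nat.mul_le_mul_right _ (by omega)
  · rw [factor, dif_neg hC, if_neg h, zero_mul]
    exact Nat.zero_le _

theorem factor_le {k : ℕ} (φ : Fin k → D) (C : Constraint (Γ ∪ {⟨n, R⟩}) (Fin k)) :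
    factor G φ C ≤ topFactor M C := by
  by_cases h : C.Sat φ
  · exact (H.factor_of_sat h).le
  · have h1 := H.factor_of_not_sat h
    have h2 : (M - 1) * topFactor M C ≤ topFactor M C * M := by
      rw [mul_comm]; exact Nat.mul_le_mul_left _ (Nat.sub_le _ _)
    exact Nat.le_of_mul_le_mul_right (h1.trans h2) H.pos

theorem prod_of_sat {k : ℕ} {φ : Fin k → D} {l : List (Constraint (Γ ∪ {⟨n, R⟩}) (Fin k))}
    (h : ∀ C ∈ l, C.Sat φ) : (l.map (factor G φ)).prod = (l.map (topFactor M)).prod := by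
  rw [List.map_congr_left fun C hC => H.factor_of_sat (h C hC)]

theorem prod_le {k : ℕ} (φ : Fin k → D) (l : List (Constraint (Γ ∪ {⟨n, R⟩}) (Fin k))) :
    (l.map (factor G φ)).prod ≤ (l.map (topFactor M)).prod :=
  List.prod_le_prod' fun C _ => H.factor_le φ C

/-- A single violated constraint supplies the loss; every other factor is at most its top value. -/
theorem prod_of_not_sat {k : ℕ} {φ : Fin k → D}
    {l : List (Constraint (Γ ∪ {⟨n, R⟩}) (Fin k))} (h : ¬ ∀ C ∈ l, C.Sat φ) :
    (l.map (factor G φ)).prod * M ≤ (M - 1) * (l.map (topFactor M)).prod := by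
  induction l with
  | nil => simp at h
  | cons C l ih =>
    simp only [List.map_cons, List.prod_cons]
    by_cases hC : C.Sat φ
    · rw [H.factor_of_sat hC, mul_assoc, mul_left_comm (M - 1)]
      exact Nat.mul_le_mul_left _ (ih fun hl => h (List.forall_mem_cons.2 ⟨hC, hl⟩))
    · calc factor G φ C * (l.map (factor G φ)).prod * M
          = factor G φ C * M * (l.map (factor G φ)).prod := by ring
        _ ≤ (M - 1) * topFactor M C * (l.map (topFactor M)).prod :=
          Nat.mul_le_mul (H.factor_of_not_sat hC) (H.prod_le φ l)
        _ = _ := by ring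

theorem norm_pos {k : ℕ} (l : List (Constraint (Γ ∪ {⟨n, R⟩}) (Fin k))) (m : ℕ) :
    0 < (Stage.rounds G M l m).norm := by
  rw [Stage.norm_rounds]
  refine pow_pos (List.prod_pos fun x hx => ?_) m
  obtain ⟨C, -, rfl⟩ := List.mem_map.1 hx
  rw [topFactor]
  split_ifs
  exacts [H.pos, one_pos]

end IsGadget

/-- The number of solutions of the new instance is close to `norm` times the number of solutions
of the given instance. -/
theorem IsGadget.card_bounds [Finite D] (H : IsGadget G M R) {k : ℕ}
    (P : CSPInstance (Γ ∪ {⟨n, R⟩}) (Fin k)) {L : ℕ} {S : Stage Γ k}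
    (hS : S = Stage.rounds G M P.constraints (M * L)) :
    Nat.card {φ : Fin k → D // P.IsSolution φ} * S.norm ≤
        Nat.card {ψ // (⟨S.cons⟩ : CSPInstance Γ (Fin S.size)).IsSolution ψ} ∧
      Nat.card {ψ // (⟨S.cons⟩ : CSPInstance Γ (Fin S.size)).IsSolution ψ} * 2 ^ L ≤
        Nat.card {φ : Fin k → D // P.IsSolution φ} * S.norm * 2 ^ L +
          Nat.card D ^ k * S.norm := by
  classical
  have := Fintype.ofFinite D
  have hcount : ∀ φ, P.IsSolution φ → S.count φ = S.norm := fun φ hφ => by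
    rw [hS, Stage.count_rounds, Stage.norm_rounds, H.prod_of_sat hφ]
  -- Raise the loss per round to the power `M * L`, use `(M - 1) ^ M * 2 ≤ M ^ M` to the power `L`,
  -- and cancel `M ^ (M * L)`.
  have hcount' : ∀ φ, ¬ P.IsSolution φ → S.count φ * 2 ^ L ≤ S.norm := fun φ hφ => by
    rw [hS, Stage.count_rounds, Stage.norm_rounds]
    have h1 := Nat.pow_le_pow_left (H.prod_of_not_sat hφ) (M * L)
    have h2 := Nat.pow_le_pow_left (sub_one_pow_mul_two_le H.pos) L
    rw [mul_pow, mul_pow] at h1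
    rw [mul_pow, ← pow_mul, ← pow_mul] at h2
    refine Nat.le_of_mul_le_mul_right ?_ (pow_pos H.pos (M * L))
    calc _ = _ * M ^ (M * L) * 2 ^ L := by rw [mul_right_comm]
      _ ≤ _ := Nat.mul_le_mul_right _ h1
      _ = (M - 1) ^ (M * L) * 2 ^ L * _ := by rw [mul_right_comm]
      _ ≤ _ := Nat.mul_le_mul_right _ h2
      _ = _ := mul_comm _ _
  have hN : Nat.card {φ : Fin k → D // P.IsSolution φ} * S.norm =
      ∑ φ : Fin k → D, if P.IsSolution φ then S.norm else 0 := by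
    rw [← Finset.sum_filter, Finset.sum_const, smul_eq_mul, Nat.card_eq_fintype_card,
      Fintype.card_subtype]
  rw [S.sum_count, hN]
  refine ⟨Finset.sum_le_sum fun φ _ => ?_, ?_⟩
  · split_ifs with h
    exacts [(hcount φ h).ge, Nat.zero_le _]
  · have hc : Nat.card D ^ k * S.norm = ∑ _φ : Fin k → D, S.norm := by simp
    rw [hc, Finset.sum_mul, Finset.sum_mul, ← Finset.sum_add_distrib]
    refine Finset.sum_le_sum fun φ _ => ?_
    split_ifs with h
    · rw [hcount φ h]; exact Nat.le_add_right _ _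
    · rw [zero_mul, zero_add]; exact hcount' φ h

/-- A max-implementation of `R` can be assumed to allow at least one extension. -/
theorem HasMaxImplementation.exists_isGadget [Finite D] (hR : HasMaxImplementation Γ R) :
    ∃ (q : ℕ) (G : CSPInstance Γ (Fin n ⊕ Fin q)) (M : ℕ), IsGadget G M R := by
  by_cases hU : ∀ φ, φ ∈ R
  -- If `R` is the full relation, the given implementation may have maximum `0`, which could not be
  -- divided out; the empty instance has exactly one extension everywhere.
  · refine ⟨0, ⟨[]⟩, 1, one_pos, fun φ _ => ?_, fun φ hφ => absurd (hU φ) hφ⟩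
    have : Unique {ψ : Fin 0 → D //
        (⟨[]⟩ : CSPInstance Γ (Fin n ⊕ Fin 0)).IsSolution (Sum.elim φ ψ)} :=
      { default := ⟨Fin.elim0, fun _ hC => absurd hC List.not_mem_nil⟩
        uniq := fun ψ => Subtype.ext (Subsingleton.elim _ _) }
    exact Nat.card_unique
  · push Not at hU
    obtain ⟨φ₀, hφ₀⟩ := hU
    obtain ⟨q, G, hG⟩ := hR
    have : Nonempty (Fin n → D) := ⟨φ₀⟩
    obtain ⟨φ₁, hφ₁⟩ := Finite.exists_max G.extensions
    have hlt : ∀ φ ∉ R, G.extensions φ < G.extensions φ₁ := fun φ hφ => by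
      by_contra! h
      exact hφ ((hG φ).2 fun φ' => (hφ₁ φ').trans h)
    -- The maximum is positive because it strictly exceeds the count at `φ₀`, which lies outside
    -- `R`.
    exact ⟨q, G, G.extensions φ₁, (Nat.zero_le _).trans_lt (hlt φ₀ hφ₀),
      fun φ hφ => (hφ₁ φ).antisymm ((hG φ).1 hφ φ₁), hlt⟩

end Stages

/-! ## Reading off the answer -/

/-- From the factor `z` and the answer `a / b` of the oracle, compute the output `a / (b z)`,
or `0` if this number is less than `1 / 2`. -/
noncomputable def readOff (x : Data) : Data :=
  open Classical in
  let z := Op.fst.eval x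
  let a := Op.fst.eval (Op.snd.eval x)
  let b := Op.snd.eval (Op.snd.eval x)
  if Op.sub.eval (.pair (Op.mul.eval (.pair b z)) (Op.mul.eval (.pair (.num 2) a))) = .num 0 then
    .pair a (Op.mul.eval (.pair b z)) else .pair (.num 0) (.num 1)

theorem polyTime_readOff : PolyTime Data.size (fun x => x) readOff := by
  have h0 : PolyTime Data.size (fun x => x) fun x => x := PolyTime.refl (PolyBdd.self _)
  have hz := h0.op .fst
  have ha := (h0.op .snd).op .fst
  have hb := (h0.op .snd).op .snd
  have hbz := (hb.pair hz).op .mul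
  have h2 := PolyTime.const h0.size_left 2
  refine PolyTime.ite ((hbz.pair ((h2.pair ha).op .mul)).op .sub) ?_ ?_
  · refine (PolyTime.pair (h2.op (.const 0)) (h2.op (.const 1))).comap Subtype.val |>.congr ?_
    intro x
    exact (if_neg x.2).symm
  · refine (ha.pair hbz).comap Subtype.val |>.congr ?_
    intro x
    exact (if_pos x.2).symm

/-- Here `S` is the true count of the query, between `N * Z` and `N * Z + Z / (4 * E)`, and `c = a /
b` is the answer. As `E ≥ 2`, `c` is within `S / 8` of `S` when `S ≠ 0`, and `c = 0` otherwise. So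
`N = 0` forces `c < Z / 2` and `N ≥ 1` forces `c > Z / 2`: the cut-off decides correctly. In the
second case the surplus and the oracle error add up to less than `N * Z / E`. -/
theorem isApprox_readOff {N S Z E : ℕ} {ε : ℝ} {y : Data} (hZ : 0 < Z) (hε : 0 < ε)
    (hE : 1 / ε ≤ E) (hE2 : 2 ≤ E) (h1 : N * Z ≤ S) (h2 : S * (4 * E) ≤ N * Z * (4 * E) + Z)
    (hy : IsApprox y S (1 / (4 * E))) : IsApprox (readOff (.pair (.num Z) y)) N ε := by
  obtain ⟨a, b, hb, rfl, hS0, hS⟩ := hy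
  have hout : readOff (.pair (.num Z) (.pair (.num a) (.num b))) =
      if b * Z - 2 * a = 0 then .pair (.num a) (.num (b * Z)) else .pair (.num 0) (.num 1) := by
    simp [readOff, Op.eval]
  rw [hout]
  have hZ' : (0 : ℝ) < Z := by exact_mod_cast hZ
  have hb' : (0 : ℝ) < b := by exact_mod_cast Nat.pos_of_ne_zero hb
  have hE2' : (2 : ℝ) ≤ E := by exact_mod_cast hE2
  have hE' : (0 : ℝ) < E := by linarith
  have h1' : (N : ℝ) * Z ≤ S := by exact_mod_cast h1
  have h2' : (S : ℝ) * (4 * E) ≤ N * Z * (4 * E) + Z := by exact_mod_cast h2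
  have hzero : S = 0 → N = 0 := fun h => by
    subst h
    rcases Nat.mul_eq_zero.1 (Nat.le_zero.1 h1) with h | h
    exacts [h, absurd h hZ.ne']
  set c : ℝ := a / b with hc
  have hac : (a : ℝ) = c * b := by rw [hc]; field_simp
  have hSc : S ≠ 0 → |(S : ℝ) - c| * (4 * E) < S := fun h => by
    have h := hS h
    have hS' : (0 : ℝ) < S := by positivity
    rw [div_lt_div_iff₀ hS' (by positivity), one_mul] at h
    exact h
  have hlt : ¬ b * Z - 2 * a = 0 ↔ 2 * c < Z := by
    rw [Nat.sub_eq_zero_iff_le, not_le, ← Nat.cast_lt (α := ℝ)]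
    push_cast
    rw [hac, ← mul_assoc, mul_comm (b : ℝ), mul_lt_mul_iff_left₀ hb']
  have key1 : N = 0 → 2 * c < Z := by
    rintro rfl
    by_cases h : S = 0
    · rw [hc, hS0 h]; simpa using hZ'
    · have := (abs_lt.1 (lt_of_mul_lt_mul_right ((hSc h).trans_le (by nlinarith :
        (S : ℝ) ≤ S / 8 * (4 * E))) (by positivity))).1
      have : (S : ℝ) * 8 ≤ Z := by push_cast at h2'; nlinarith
      linarith
  have key2 : N ≠ 0 → ¬ 2 * c < Z := by
    intro hN h
    have hN' : (1 : ℝ) ≤ N := by exact_mod_cast Nat.one_le_iff_ne_zero.2 hN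
    have hS0 : S ≠ 0 := mt hzero hN
    have := (abs_lt.1 (lt_of_mul_lt_mul_right ((hSc hS0).trans_le (by nlinarith :
        (S : ℝ) ≤ S / 8 * (4 * E))) (by positivity))).2
    nlinarith
  split_ifs with h
  · refine ⟨a, b * Z, mul_ne_zero hb hZ.ne', rfl, fun hN => ?_, fun hN => ?_⟩
    · exact absurd h (hlt.2 (key1 hN))
    · have hS0 : S ≠ 0 := mt hzero hN
      have hN' : (1 : ℝ) ≤ N := by exact_mod_cast Nat.one_le_iff_ne_zero.2 hN
      have hEε : 1 ≤ E * ε := by rwa [div_le_iff₀ hε] at hE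
      have hcZ : (a : ℝ) / ((b * Z : ℕ) : ℝ) = c / Z := by
        push_cast; rw [hc]; field_simp
      have hd := hSc hS0
      rw [hcZ, div_lt_iff₀ (by linarith)]
      have hrw : (N : ℝ) - c / Z = (N * Z - c) / Z := by field_simp
      rw [hrw, abs_div, abs_of_pos hZ', div_lt_iff₀ hZ']
      have h3 : |(N : ℝ) * Z - c| ≤ |(S : ℝ) - c| + (S - N * Z) := by
        rw [abs_le]
        have := abs_le.1 (le_refl |(S : ℝ) - c|)
        constructor <;> linarith [this.1, this.2]
      have h4 : |(N : ℝ) * Z - c| * (4 * E) < S + Z := by nlinarith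
      have h5 : (S : ℝ) ≤ N * Z + Z := by nlinarith
      -- `S + Z ≤ N * Z + 2 * Z ≤ 3 * (N * Z)`, using `N ≥ 1`.
      have h6 : |(N : ℝ) * Z - c| * (4 * E) < N * Z * 4 * 1 := by nlinarith
      have h7 : (N : ℝ) * Z * 4 * 1 ≤ N * Z * 4 * (E * ε) :=
        mul_le_mul_of_nonneg_left hEε (by positivity)
      refine lt_of_mul_lt_mul_right (a := 4 * (E : ℝ)) ?_ (by positivity)
      linarith
  · refine ⟨0, 1, one_ne_zero, rfl, fun _ => rfl, fun hN => ?_⟩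
    exact absurd (hlt.1 h) (key2 hN)

/-! ## The reduction -/

section Reduction

variable {D : Type*} [Finite D] {Γ : Set (Rel D)} {n q : ℕ} {R : Set (Fin n → D)}
  (G : CSPInstance Γ (Fin n ⊕ Fin q)) (M : ℕ)

/-- A list of constraints, written down. -/
noncomputable def encodeList {Γ : Set (Rel D)} {k : ℕ} (l : List (Constraint Γ (Fin k))) : Data :=
  .ofList (l.map Constraint.encode)

/-- A stage, written down. -/
noncomputable def Stage.encode {k : ℕ} (S : Stage Γ k) : Data :=
  .pair (.pair (.num S.size) (.num S.norm)) (encodeList S.cons)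

theorem ofNats_ofFn {m : ℕ} (f : Fin m → ℕ) :
    Data.ofNats (List.ofFn f) = .ofList (List.ofFn fun i => .num (f i)) := by
  rw [Data.ofNats, List.map_ofFn]; rfl

theorem Constraint.encode_scopeOf {Γ : Set (Rel D)} {k : ℕ} (C : Constraint Γ (Fin k))
    (h : C.rel = ⟨n, R⟩) :
    C.encode = .pair (.num (relName C.rel)) (.ofList (List.ofFn fun i => .num (C.scopeOf h i))) := by
  obtain ⟨rel, mem, scope⟩ := C
  dsimp only at h
  subst h
  rw [Constraint.encode, ofNats_ofFn]
  rfl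

/-- `G`, `M` and the name of `R` are fixed, so they are built into the program; only the stage and
the constraint are input. -/
theorem polyTime_step :
    PolyTime (fun x : Σ k, Stage Γ k × Constraint (Γ ∪ {⟨n, R⟩}) (Fin k) =>
        (Data.pair x.2.1.encode x.2.2.encode).size)
      (fun x => .pair x.2.1.encode x.2.2.encode) fun x => (x.2.1.step G M x.2.2).encode := by
  set w := fun x : Σ k, Stage Γ k × Constraint (Γ ∪ {⟨n, R⟩}) (Fin k) =>
        (Data.pair x.2.1.encode x.2.2.encode).size
  set e := fun x : Σ k, Stage Γ k × Constraint (Γ ∪ {⟨n, R⟩}) (Fin k) =>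
        Data.pair x.2.1.encode x.2.2.encode
  have h0 : PolyTime w e e := PolyTime.refl (PolyBdd.self _)
  have hsize : PolyTime w e fun x => .num x.2.1.size := h0.fst.fst.fst
  have hnorm : PolyTime w e fun x => .num x.2.1.norm := h0.fst.fst.snd
  have hcons : PolyTime w e fun x => encodeList x.2.1.cons := h0.fst.snd
  have hC : PolyTime w e fun x => x.2.2.encode := h0.snd
  have hname : PolyTime w e fun x => .num (relName x.2.2.rel) := hC.fst
  have hr := PolyTime.const h0.size_left (relName (⟨n, R⟩ : Rel D))
  -- With truncated subtraction, `(a - b) + (b - a)` vanishes exactly when the two names agree.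
  refine PolyTime.ite ((hname.sub hr).add (hr.sub hname)) ?_ ?_
  -- Variables are written by their values, so `Fin.castLE` does not alter the encoding and the
  -- constraint is simply prepended.
  · refine (((hsize.pair hnorm).pair (hC.pair hcons)).comap Subtype.val).congr ?_
    rintro ⟨⟨k, S, C⟩, hx⟩
    have h : C.rel ≠ ⟨n, R⟩ := by
      rintro h
      simp [h] at hx
    dsimp only
    rw [Stage.step, dif_neg h]
    rfl
  · set v : {x : Σ k, Stage Γ k × Constraint (Γ ∪ {⟨n, R⟩}) (Fin k) //
        Data.num (relName x.2.2.rel - relName (⟨n, R⟩ : Rel D) +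
          (relName (⟨n, R⟩ : Rel D) - relName x.2.2.rel)) = .num 0} → _ := Subtype.val
    have hrel : ∀ x, (v x).2.2.rel = ⟨n, R⟩ := by
      intro x
      have := Data.num.inj x.2
      change relName (v x).2.2.rel - _ + (_ - relName (v x).2.2.rel) = 0 at this
      exact relName_injective (by omega)
    have hscope : PolyTime (fun x => w (v x)) (fun x => e (v x))
        fun x => .ofList (List.ofFn fun i => .num ((v x).2.2.scopeOf (hrel x) i)) :=
      ((hC.comap v).congr fun x => (v x).2.2.encode_scopeOf (hrel x)).snd
    have hbd := (h0.comap v).size_left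
    have hvar : ∀ j : Fin n ⊕ Fin q, PolyTime (fun x => w (v x)) (fun x => e (v x)) fun x =>
        .num (Sum.elim (fun i => Fin.castAdd q (Fin.castLE (v x).2.1.le
          ((v x).2.2.scopeOf (hrel x) i))) (Fin.natAdd (v x).2.1.size) j : Fin _) := by
      rintro (i | i)
      · exact hscope.getElem i
      · exact (hsize.comap v).add (PolyTime.const hbd (i : ℕ))
    have hcopy : ∀ C : Constraint Γ (Fin n ⊕ Fin q), PolyTime (fun x => w (v x))
        (fun x => e (v x)) fun x => (C.map (Sum.elim (fun i => Fin.castAdd q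
          (Fin.castLE (v x).2.1.le ((v x).2.2.scopeOf (hrel x) i)))
            (Fin.natAdd (v x).2.1.size))).encode := by
      intro C
      have hl := PolyTime.prepend (l := fun _ => []) (List.ofFn fun j x => _)
        (fun u hu => by
          obtain ⟨j, rfl⟩ := (List.mem_ofFn' _ _).1 hu
          exact hvar (C.scope j)) (PolyTime.const hbd 0)
      refine ((PolyTime.const hbd (relName C.rel)).pair hl).congr fun x => ?_
      rw [Constraint.encode, ofNats_ofFn, List.map_ofFn, List.append_nil]
      rfl
    refine (((hsize.comap v).add (PolyTime.const hbd q)).pair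
      ((hnorm.comap v).mul (PolyTime.const hbd M))).pair (PolyTime.prepend
        (G.constraints.map fun C x => (C.map (Sum.elim (fun i => Fin.castAdd q
          (Fin.castLE (v x).2.1.le ((v x).2.2.scopeOf (hrel x) i)))
            (Fin.natAdd (v x).2.1.size))).encode) ?_ (hcons.comap v)) |>.congr fun x => ?_
    · intro u hu
      obtain ⟨C, -, rfl⟩ := List.mem_map.1 hu
      exact hcopy C
    · have h := hrel x
      change _ = ((v x).2.1.step G M (v x).2.2).encode
      rw [Stage.step, dif_pos h, Stage.encode, encodeList, Stage.addGadget]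
      simp only [List.map_append, List.map_map]
      rfl

/-! ### Length bounds for stages -/

/-- The size of a stage that arises by adding at most `N` constraints. -/
structure Stage.Bounded {k : ℕ} (S : Stage Γ k) (N : ℕ) : Prop where
  size_le : S.size ≤ k + q * N
  length_le : S.cons.length ≤ (G.constraints.length + 1) * N
  norm_le : Nat.size S.norm ≤ Nat.size M * N + 1

variable {G M}

omit [Finite D] in
theorem Stage.Bounded.mono {k : ℕ} {S : Stage Γ k} {N N' : ℕ} (h : S.Bounded G M N)
    (hN : N ≤ N') : S.Bounded G M N' :=
  ⟨h.size_le.trans (by gcongr), h.length_le.trans (by gcongr), h.norm_le.trans (by gcongr)⟩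

omit [Finite D] in
theorem Stage.bounded_init (k N : ℕ) : (Stage.init Γ k).Bounded G M N :=
  ⟨Nat.le_add_right _ _, Nat.zero_le _, by simp [Stage.init]⟩

omit [Finite D] in
theorem Stage.Bounded.step {k : ℕ} {S : Stage Γ k} {N : ℕ} (h : S.Bounded G M N)
    (C : Constraint (Γ ∪ {⟨n, R⟩}) (Fin k)) : (S.step G M C).Bounded G M (N + 1) := by
  obtain ⟨h1, h2, h3⟩ := h
  by_cases hC : C.rel = ⟨n, R⟩
  · rw [Stage.step, dif_pos hC]
    refine ⟨?_, ?_, ?_⟩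
    · simp only [Stage.addGadget, Nat.mul_add]; omega
    · simp only [Stage.addGadget, Nat.mul_add, List.length_append, List.length_map]; omega
    · have := size_mul_le_add S.norm M
      simp only [Stage.addGadget, Nat.mul_add]; omega
  · rw [Stage.step, dif_neg hC]
    refine ⟨?_, ?_, ?_⟩
    · simp only [Stage.addConstraint, Nat.mul_add]; omega
    · simp only [Stage.addConstraint, Nat.mul_add, List.length_cons]; omega
    · simp only [Stage.addConstraint, Nat.mul_add]; omega

omit [Finite D] in
theorem Stage.Bounded.round {k : ℕ} {S : Stage Γ k} {N : ℕ} (h : S.Bounded G M N)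
    (l : List (Constraint (Γ ∪ {⟨n, R⟩}) (Fin k))) :
    (S.round G M l).Bounded G M (N + l.length) := by
  induction l generalizing S N with
  | nil => exact h
  | cons C l ih =>
    rw [List.length_cons, add_comm l.length, ← add_assoc]
    exact ih (h.step C)

omit [Finite D] in
theorem Stage.bounded_rounds {k : ℕ} (l : List (Constraint (Γ ∪ {⟨n, R⟩}) (Fin k))) (m : ℕ) :
    (Stage.rounds G M l m).Bounded G M (m * l.length) := by
  induction m with
  | zero => exact Stage.bounded_init _ _
  | succ m ih =>
    rw [Stage.rounds_succ, Nat.succ_mul]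
    exact ih.round l

/-- Finiteness of `Γ` bounds both the arities and the names of its relations. -/
theorem exists_size_encode_le (hΓ : Γ.Finite) : ∃ c : ℕ, ∀ (k : ℕ) (C : Constraint Γ (Fin k)),
    C.encode.size ≤ c * (k + 3) + 3 := by
  obtain ⟨c, hc⟩ := (hΓ.image fun r => r.1 + relName r).bddAbove
  refine ⟨c, fun k C => ?_⟩
  have h1 : C.rel.1 + relName C.rel ≤ c := hc ⟨C.rel, C.mem, rfl⟩
  have h2 := size_le_self (relName C.rel)
  have h3 : (Data.ofList (List.ofFn fun i => .num (C.scope i))).size ≤ C.rel.1 * (k + 2) + 1 := by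
    refine (Data.size_ofList_le (B := k + 1) fun a ha => ?_).trans (by simp)
    obtain ⟨i, rfl⟩ := (List.mem_ofFn' _ _).1 ha
    have := size_le_self (C.scope i)
    simp only [Data.size]
    omega
  rw [Constraint.encode, ofNats_ofFn]
  simp only [Data.size]
  nlinarith [Nat.mul_le_mul_right (k + 2) (le_trans (Nat.le_add_right _ _) h1)]

/-- Iterating a polynomial-time step need not stay polynomial. This bound, whose constant is
independent of `k` and `N`, controls all intermediate states of the loops at once. -/
theorem exists_size_encode_stage_le (hΓ : Γ.Finite) : ∃ c : ℕ, ∀ (k N : ℕ) (S : Stage Γ k),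
    S.Bounded G M N →
      S.encode.size ≤ c * (N + 1) * (k + N + 1) := by
  obtain ⟨c, hc⟩ := exists_size_encode_le hΓ
  refine ⟨(G.constraints.length + 1) * ((c + 1) * (q + 4)) + Nat.size M + q + 7,
    fun k N S h => ?_⟩
  have h1 := h.size_le
  have h2 := size_le_self S.size
  have h3 : (encodeList S.cons).size ≤
      (G.constraints.length + 1) * N * ((c + 1) * ((q + 4) * (k + N + 1))) + 1 := by
    refine (Data.size_ofList_le (B := c * (S.size + 3) + 3) fun a ha => ?_).trans ?_
    · obtain ⟨C, -, rfl⟩ := List.mem_map.1 ha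
      exact hc _ C
    · rw [List.length_map]
      refine Nat.add_le_add_right (Nat.mul_le_mul h.length_le ?_) 1
      have : S.size + 4 ≤ (q + 4) * (k + N + 1) := by nlinarith
      nlinarith
  have h4 := h.norm_le
  simp only [Stage.encode, Data.size]
  have h5 : (G.constraints.length + 1) * N * ((c + 1) * ((q + 4) * (k + N + 1))) ≤
      (G.constraints.length + 1) * ((c + 1) * (q + 4)) * ((N + 1) * (k + N + 1)) := by
    calc _ = (G.constraints.length + 1) * ((c + 1) * (q + 4)) * (N * (k + N + 1)) := by ring
      _ ≤ _ := by gcongr; omega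
  have h6 : k + N + 1 ≤ (N + 1) * (k + N + 1) := Nat.le_mul_of_pos_left _ (by omega)
  have h7 := Nat.mul_le_mul_left (Nat.size M) h6
  have h8 := Nat.mul_le_mul_left q h6
  have h9 : Nat.size M * N ≤ Nat.size M * (k + N + 1) := by gcongr; omega
  have h10 : q * N ≤ q * (k + N + 1) := by gcongr; omega
  nlinarith

/-! ### Programs for rounds and for the parameters of the reduction -/

variable (G M)

theorem polyTime_round {α : Type*} {w k : α → ℕ} {S : ∀ a, Stage Γ (k a)}
    {l : ∀ a, List (Constraint (Γ ∪ {⟨n, R⟩}) (Fin (k a)))}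
    (hl : PolyBdd w fun a => (encodeList (l a)).size)
    (hS : PolyBdd (fun x : {x : α × ℕ // x.2 ≤ (l x.1).length} => w x.1.1)
      fun x => ((S x.1.1).round G M ((l x.1.1).take x.1.2)).encode.size) :
    PolyTime w (fun a => .pair (encodeList (l a)) (S a).encode)
      fun a => ((S a).round G M (l a)).encode := by
  have hS0 : PolyBdd w fun a => (S a).encode.size :=
    hS.comap fun a => ⟨(a, 0), Nat.zero_le _⟩
  have h0 : PolyTime w (fun a => .pair (encodeList (l a)) (S a).encode)
      fun a => .pair (encodeList (l a)) (S a).encode :=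
    PolyTime.refl (((hl.add hS0).add (PolyBdd.const w 1)).mono fun a => le_rfl)
  have hS' : PolyBdd (fun x : {x : α × ℕ // x.2 ≤ ((l x.1).map Constraint.encode).length} =>
      w x.1.1) fun x => ((S x.1.1).round G M ((l x.1.1).take x.1.2)).encode.size :=
    hS.comap fun x : {x : α × ℕ // x.2 ≤ ((l x.1).map Constraint.encode).length} =>
      (⟨x.1, x.2.trans_eq (List.length_map _)⟩ : {x : α × ℕ // x.2 ≤ (l x.1).length})
  have hfold := PolyTime.fold (l := fun a => (l a).map Constraint.encode)
    (st := fun a i => ((S a).round G M ((l a).take i)).encode) h0.fst h0.snd hS'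
  refine (hfold ?_).congr fun a => ?_
  · clear hfold
    have hlt : ∀ x : {x : α × ℕ // x.2 < ((l x.1).map Constraint.encode).length},
        x.1.2 < (l x.1.1).length :=
      fun x => x.2.trans_eq (List.length_map _)
    have hw : PolyBdd
        (fun x : {x : α × ℕ // x.2 < ((l x.1).map Constraint.encode).length} => w x.1.1)
        fun x => (Data.pair ((S x.1.1).round G M ((l x.1.1).take x.1.2)).encode
          ((l x.1.1)[x.1.2]'(hlt x)).encode).size :=
      (((hS'.comap fun x : {x : α × ℕ // x.2 < ((l x.1).map Constraint.encode).length} =>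
        ⟨x.1, x.2.le⟩).add (hl.comap
          fun x : {x : α × ℕ // x.2 < ((l x.1).map Constraint.encode).length} => x.1.1)).add
            (PolyBdd.const _ 1)).mono fun x => by
          have := Data.size_le_size_ofList
            (List.mem_map_of_mem (f := Constraint.encode) (List.getElem_mem (hlt x)))
          simp only [Data.size, encodeList]
          omega
    -- One step is timed in its own input length; `hw` converts this to the parameter `w`.
    have hstep := ((polyTime_step G M).comap
      fun x : {x : α × ℕ // x.2 < ((l x.1).map Constraint.encode).length} =>
        (⟨k x.1.1, (S x.1.1).round G M ((l x.1.1).take x.1.2), (l x.1.1)[x.1.2]'(hlt x)⟩ :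
          Σ k, Stage Γ k × Constraint (Γ ∪ {⟨n, R⟩}) (Fin k))).weight hw
    refine (hstep.congr_left fun x => ?_).congr fun x => ?_
    · rw [List.getElem_map]
    · rw [List.take_add_one, List.getElem?_eq_getElem (hlt x), Stage.round, Stage.round,
        List.foldl_append]
      rfl
  · rw [List.length_map, List.take_length]

/-- The constraints of an instance and the stages of the reduction. -/
theorem polyTime_rounds (hΓ : Γ.Finite) {α : Type*} {w k m : α → ℕ} {e : α → Data}
    {l : ∀ a, List (Constraint (Γ ∪ {⟨n, R⟩}) (Fin (k a)))}
    (hk : PolyTime w e fun a => .num (k a)) (hkb : PolyBdd w k)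
    (hm : PolyTime w e fun a => .num (m a)) (hmb : PolyBdd w m)
    (hl : PolyTime w e fun a => encodeList (l a)) :
    PolyTime w e fun a => (Stage.rounds G M (l a) (m a)).encode := by
  obtain ⟨c, hc⟩ := exists_size_encode_stage_le (G := G) (M := M) hΓ
  have hlen : PolyBdd w fun a => (l a).length := hl.size_right.mono fun a => by
    rw [← List.length_map (f := Constraint.encode)]
    exact Data.length_le_size_ofList _
  have hN : PolyBdd w fun a => m a * (l a).length + (l a).length :=
    (hmb.mul hlen).add hlen
  have hB : PolyBdd w fun a => c * (m a * (l a).length + (l a).length + 1) *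
      (k a + (m a * (l a).length + (l a).length) + 1) :=
    ((PolyBdd.const w c).mul (hN.add (PolyBdd.const w 1))).mul
      ((hkb.add hN).add (PolyBdd.const w 1))
  have hbound : ∀ a, ∀ i ≤ m a, ∀ j : ℕ,
      ((Stage.rounds G M (l a) i).round G M ((l a).take j)).encode.size ≤
        c * (m a * (l a).length + (l a).length + 1) *
      (k a + (m a * (l a).length + (l a).length) + 1) := by
    intro a i hi j
    refine hc _ _ _ (((Stage.bounded_rounds (l a) i).round _).mono ?_)
    exact Nat.add_le_add (Nat.mul_le_mul_right _ hi) (List.length_take_le' _ _)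
  have hbound' : ∀ a, ∀ i ≤ m a, (Stage.rounds G M (l a) i).encode.size ≤
        c * (m a * (l a).length + (l a).length + 1) *
      (k a + (m a * (l a).length + (l a).length) + 1) := fun a i hi => hbound a i hi 0
  have hstate : PolyBdd (fun x : {x : α × ℕ // x.2 ≤ m x.1} => w x.1.1) fun x =>
      (Data.pair (.num (m x.1.1 - x.1.2))
        (.pair (encodeList (l x.1.1)) (Stage.rounds G M (l x.1.1) x.1.2).encode)).size :=
    ((((hmb.add hl.size_right).add hB).add (PolyBdd.const w 3)).comap
      fun x : {x : α × ℕ // x.2 ≤ m x.1} => x.1.1).mono fun x => by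
        have h1 := size_le_self (m x.1.1 - x.1.2)
        have h2 := hbound' x.1.1 x.1.2 x.2
        simp only [Data.size]
        omega
  have hzero : PolyTime w e fun _ => .num 0 := PolyTime.const hk.size_left 0
  have hone : PolyTime w e fun _ => .num 1 := PolyTime.const hk.size_left 1
  -- The counter runs downwards so that it is its own loop test, and the constraint list stays in
  -- the state because every round reads it again.
  refine (PolyTime.loop (st := fun a i => .pair (.num (m a - i))
      (.pair (encodeList (l a)) (Stage.rounds G M (l a) i).encode))
    (test := fun a i => .num (m a - i)) hmb
    (hm.pair (hl.pair ((hk.pair hone).pair hzero))) (PolyTime.refl hstate).fst ?_ ?_ ?_).snd.snd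
  · intro a i hi h
    have := Data.num.inj h
    omega
  · intro a
    rw [Nat.sub_self]
  · have hr := PolyTime.refl (hstate.comap
      fun x : {x : α × ℕ // x.2 < m x.1} => ⟨x.1, x.2.le⟩)
    have hround := polyTime_round G M (w := fun x : {x : α × ℕ // x.2 < m x.1} => w x.1.1)
      (S := fun x => Stage.rounds G M (l x.1.1) x.1.2) (l := fun x => l x.1.1)
      (hl.size_right.comap fun x : {x : α × ℕ // x.2 < m x.1} => x.1.1)
      ((hB.comap fun x : {x : {x : α × ℕ // x.2 < m x.1} × ℕ //
          x.2 ≤ (l x.1.1.1).length} => x.1.1.1.1).mono fun x =>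
        hbound x.1.1.1.1 x.1.1.1.2 x.1.1.2.le x.1.2)
    refine ((hr.fst.sub (PolyTime.const hr.size_left 1)).pair
      (hr.snd.fst.pair (hr.snd.trans hround))).congr fun x => ?_
    rw [Stage.rounds_succ]
    rfl

/-- Writing down the list of the first `K a` natural numbers. -/
theorem polyTime_range {α : Type*} {w K : α → ℕ} {e : α → Data}
    (hK : PolyTime w e fun a => .num (K a)) (hKb : PolyBdd w K) :
    PolyTime w e fun a => Data.ofNats (List.range (K a)) := by
  have hzero : PolyTime w e fun _ => .num 0 := PolyTime.const hK.size_left 0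
  have hsize : PolyBdd (fun x : {x : α × ℕ // x.2 ≤ K x.1} => w x.1.1) fun x =>
      (Data.pair (.num (K x.1.1 - x.1.2))
        (Data.ofNats (List.range' (K x.1.1 - x.1.2) x.1.2))).size :=
    (((hKb.add (hKb.mul (hKb.add (PolyBdd.const w 2)))).add (PolyBdd.const w 3)).comap
      fun x : {x : α × ℕ // x.2 ≤ K x.1} => x.1.1).mono fun x => by
        have h1 := size_le_self (K x.1.1 - x.1.2)
        have h2 : (Data.ofNats (List.range' (K x.1.1 - x.1.2) x.1.2)).size ≤
            x.1.2 * (K x.1.1 + 1 + 1) + 1 := by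
          refine (Data.size_ofList_le (B := K x.1.1 + 1) fun y hy => ?_).trans (by simp)
          obtain ⟨i, hi, rfl⟩ := List.mem_map.1 hy
          have := List.mem_range'_1.1 hi
          have := size_le_self i
          have := x.2
          simp only [Data.size]
          omega
        have h3 : x.1.2 * (K x.1.1 + 1 + 1) ≤ K x.1.1 * (K x.1.1 + 2) :=
          Nat.mul_le_mul_right _ x.2
        simp only [Data.size]
        omega
  -- Lists grow at the front, so the range is written from its last entry down.
  refine (PolyTime.loop (st := fun a i => .pair (.num (K a - i))
      (Data.ofNats (List.range' (K a - i) i))) (test := fun a i => .num (K a - i)) hKb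
    (hK.pair hzero) (PolyTime.refl hsize).fst ?_ ?_ ?_).snd.congr fun a => ?_
  · intro a i hi h
    have := Data.num.inj h
    omega
  · intro a
    rw [Nat.sub_self]
  · have h0 := PolyTime.refl (hsize.comap fun x : {x : α × ℕ // x.2 < K x.1} => ⟨x.1, x.2.le⟩)
    have hpred := h0.fst.sub (PolyTime.const h0.size_left 1)
    refine (hpred.pair (hpred.pair h0.snd)).congr fun x => ?_
    have : K x.1.1 - x.1.2 = K x.1.1 - (x.1.2 + 1) + 1 := by have := x.2; omega
    rw [List.range'_succ, ← this]
    rfl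
  · rw [Nat.sub_self, List.range_eq_range']

/-- The length of a list of numbers. -/
theorem polyTime_length {α : Type*} {w k : α → ℕ} {e : α → Data}
    (hk : PolyTime w e fun a => Data.ofNats (List.range (k a))) :
    PolyBdd w k ∧ PolyTime w e fun a => .num (k a) := by
  have hlen : ∀ a, ((List.range (k a)).map Data.num).length = k a := by simp
  -- Listing the variables makes the input at least as long as their number, so `k` itself, not just
  -- its binary length, is polynomially bounded.
  have hkb : PolyBdd w k := hk.size_right.mono fun a =>
    (hlen a).ge.trans (Data.length_le_size_ofList _)
  have hsize : PolyBdd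
      (fun x : {x : α × ℕ // x.2 ≤ ((List.range (k x.1)).map Data.num).length} => w x.1.1)
      fun x => (Data.num x.1.2).size :=
    ((hkb.add (PolyBdd.const w 1)).comap fun x : {x : α × ℕ //
      x.2 ≤ ((List.range (k x.1)).map Data.num).length} => x.1.1).mono fun x => by
        have h1 := size_le_self x.1.2
        have h2 := x.2.trans_eq (hlen _)
        simp only [Data.size]
        omega
  refine ⟨hkb, ((PolyTime.fold (st := fun _ i => .num i) hk (PolyTime.const hk.size_left 0) hsize
    ?_)).congr fun a => by rw [hlen]⟩
  have h0 := PolyTime.refl (((hsize.comap fun x : {x : α × ℕ //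
      x.2 < ((List.range (k x.1)).map Data.num).length} =>
      (⟨x.1, x.2.le⟩ : {x : α × ℕ // x.2 ≤ ((List.range (k x.1)).map Data.num).length})).add
    ((hk.size_right.comap fun x : {x : α × ℕ //
      x.2 < ((List.range (k x.1)).map Data.num).length} => x.1.1).add (PolyBdd.const _ 1))).mono
    (g := fun x => (Data.pair (.num x.1.2)
      (((List.range (k x.1.1)).map Data.num)[x.1.2]'x.2)).size) fun x => by
        have := Data.size_le_size_ofList (List.getElem_mem x.2)
        simp only [Data.size, Data.ofNats] at this ⊢
        omega)
  exact h0.fst.add (PolyTime.const h0.size_left 1)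

/-- Multiplying by a power of a constant. -/
theorem polyTime_mul_pow {α : Type*} {w k f : α → ℕ} {e : α → Data} (d : ℕ)
    (hk : PolyTime w e fun a => Data.ofNats (List.range (k a)))
    (hf : PolyTime w e fun a => .num (f a)) :
    PolyTime w e fun a => .num (f a * d ^ k a) := by
  have hlen : ∀ a, ((List.range (k a)).map Data.num).length = k a := by simp
  have hkb := (polyTime_length hk).1
  have hsize : PolyBdd
      (fun x : {x : α × ℕ // x.2 ≤ ((List.range (k x.1)).map Data.num).length} => w x.1.1)
      fun x => (Data.num (f x.1.1 * d ^ x.1.2)).size :=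
    (((hf.size_right.add (hkb.mul (PolyBdd.const w d.size))).add (PolyBdd.const w 2)).comap
      fun x : {x : α × ℕ // x.2 ≤ ((List.range (k x.1)).map Data.num).length} => x.1.1).mono
      fun x => by
        have h1 := size_mul_le_add (f x.1.1) (d ^ x.1.2)
        have h2 : Nat.size (d ^ x.1.2) ≤ x.1.2 * d.size + 1 := by
          generalize x.1.2 = i
          induction i with
          | zero => simp
          | succ i ih =>
            rw [pow_succ, Nat.succ_mul]
            have := size_mul_le_add (d ^ i) d
            omega
        have h3 : x.1.2 * d.size ≤ k x.1.1 * d.size :=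
          Nat.mul_le_mul_right _ (x.2.trans_eq (hlen _))
        simp only [Data.size]
        omega
  refine ((PolyTime.fold (st := fun a i => .num (f a * d ^ i)) hk (hf.congr fun a => by simp)
    hsize ?_)).congr fun a => by rw [hlen]
  have h0 := PolyTime.refl (((hsize.comap fun x : {x : α × ℕ //
      x.2 < ((List.range (k x.1)).map Data.num).length} =>
      (⟨x.1, x.2.le⟩ : {x : α × ℕ // x.2 ≤ ((List.range (k x.1)).map Data.num).length})).add
    ((hk.size_right.comap fun x : {x : α × ℕ //
      x.2 < ((List.range (k x.1)).map Data.num).length} => x.1.1).add (PolyBdd.const _ 1))).mono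
    (g := fun x => (Data.pair (.num (f x.1.1 * d ^ x.1.2))
      (((List.range (k x.1.1)).map Data.num)[x.1.2]'x.2)).size) fun x => by
        have := Data.size_le_size_ofList (List.getElem_mem x.2)
        simp only [Data.size, Data.ofNats] at this ⊢
        omega)
  exact (h0.fst.mul (PolyTime.const h0.size_left d)).congr fun x => by rw [pow_succ, mul_assoc]

/-- The binary length of a number. -/
theorem polyTime_size {α : Type*} {w f : α → ℕ} {e : α → Data}
    (hf : PolyTime w e fun a => .num (f a)) :
    PolyBdd w (fun a => (f a).size) ∧ PolyTime w e fun a => .num (f a).size := by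
  have hfb : PolyBdd w fun a => (f a).size :=
    hf.size_right.mono fun a => by simp only [Data.size]; omega
  have hsize : PolyBdd (fun x : {x : α × ℕ // x.2 ≤ (f x.1).size} => w x.1.1)
      fun x => (Data.pair (.num (f x.1.1 / 2 ^ x.1.2)) (.num x.1.2)).size :=
    (((hfb.add hfb).add (PolyBdd.const w 3)).comap
      fun x : {x : α × ℕ // x.2 ≤ (f x.1).size} => x.1.1).mono fun x => by
        have h1 := Nat.size_le_size (Nat.div_le_self (f x.1.1) (2 ^ x.1.2))
        have h2 := size_le_self x.1.2
        have h3 := x.2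
        simp only [Data.size]
        omega
  -- Halve until `0` is reached and count the halvings; this takes exactly `(f a).size` iterations.
  refine ⟨hfb, (PolyTime.loop (st := fun a i => .pair (.num (f a / 2 ^ i)) (.num i))
    (test := fun a i => .num (f a / 2 ^ i)) hfb
    ((hf.congr fun a => by simp).pair (PolyTime.const hf.size_left 0))
    (PolyTime.refl hsize).fst ?_ ?_ ?_).snd⟩
  · intro a i hi h
    have h := Data.num.inj h
    rw [Nat.div_eq_zero_iff_lt (by positivity), ← Nat.size_le] at h
    omega
  · intro a
    rw [Nat.div_eq_of_lt (Nat.lt_size_self _)]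
  · have h0 := PolyTime.refl (hsize.comap
      fun x : {x : α × ℕ // x.2 < (f x.1).size} => ⟨x.1, x.2.le⟩)
    refine ((h0.fst.div (PolyTime.const h0.size_left 2)).pair
      (h0.snd.add (PolyTime.const h0.size_left 1))).congr fun x => ?_
    rw [Nat.div_div_eq_div_mul, ← pow_succ]

/-- The number whose binary length determines how many copies of `G` are used. -/
noncomputable def threshold (D : Type*) (k E : ℕ) : ℕ := 4 * E * Nat.card D ^ k

/-- The last stage of the reduction. -/
noncomputable def finalStage (P : (NCSP (Γ ∪ {⟨n, R⟩})).Inst) (E : ℕ) : Stage Γ P.1 :=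
  Stage.rounds G M P.2.constraints (M * (threshold D P.1 E).size)

/-- The instance over `Γ` of the reduction. -/
noncomputable def reduced (P : (NCSP (Γ ∪ {⟨n, R⟩})).Inst) (E : ℕ) : (NCSP Γ).Inst :=
  ⟨(finalStage G M P E).size, ⟨(finalStage G M P E).cons⟩⟩

/-- The factor `norm` is carried next to the query for use after the answer. The numeral `4 * x.2`
is the error bound `1 / (4 * E)` as the oracle reads it. -/
theorem polyTime_reduced (hΓ : Γ.Finite) :
    PolyTime (fun x : (NCSP (Γ ∪ {⟨n, R⟩})).Inst × ℕ =>
        (Data.pair ((NCSP (Γ ∪ {⟨n, R⟩})).encode x.1) (.num x.2)).size)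
      (fun x => .pair ((NCSP (Γ ∪ {⟨n, R⟩})).encode x.1) (.num x.2))
      fun x => .pair (.num (finalStage G M x.1 x.2).norm)
        (.pair ((NCSP Γ).encode (reduced G M x.1 x.2)) (.num (4 * x.2))) := by
  set w := fun x : (NCSP (Γ ∪ {⟨n, R⟩})).Inst × ℕ =>
        (Data.pair ((NCSP (Γ ∪ {⟨n, R⟩})).encode x.1) (.num x.2)).size
  set e := fun x : (NCSP (Γ ∪ {⟨n, R⟩})).Inst × ℕ =>
        Data.pair ((NCSP (Γ ∪ {⟨n, R⟩})).encode x.1) (.num x.2)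
  have h0 : PolyTime w e e := PolyTime.refl (PolyBdd.self _)
  have hvars : PolyTime w e fun x => Data.ofNats (List.range x.1.1) := h0.fst.fst
  have hcons : PolyTime w e fun x => encodeList x.1.2.constraints := h0.fst.snd
  have hE : PolyTime w e fun x => .num (4 * x.2) :=
    (PolyTime.const h0.size_left 4).mul h0.snd
  obtain ⟨hkb, hk⟩ := polyTime_length hvars
  obtain ⟨hLb, hL⟩ := polyTime_size (polyTime_mul_pow (Nat.card D) hvars hE)
  have hmb := (PolyBdd.const w M).mul hLb
  have hm := (PolyTime.const h0.size_left M).mul hL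
  have hS : PolyTime w e fun x => (finalStage G M x.1 x.2).encode :=
    polyTime_rounds G M hΓ hk hkb hm hmb hcons
  have hlen : PolyBdd w fun x => x.1.2.constraints.length := hcons.size_right.mono fun a => by
    rw [← List.length_map (f := Constraint.encode)]
    exact Data.length_le_size_ofList _
  have hKb : PolyBdd w fun x => (finalStage G M x.1 x.2).size :=
    (hkb.add ((PolyBdd.const w q).mul (hmb.mul hlen))).mono fun x =>
      (Stage.bounded_rounds _ _).size_le
  exact hS.fst.snd.pair (((polyTime_range hS.fst.fst hKb).pair hS.snd).pair hE)

variable {G M}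

theorem IsGadget.isApprox_readOff (H : IsGadget G M R) (P : (NCSP (Γ ∪ {⟨n, R⟩})).Inst) {E : ℕ}
    {ε : ℝ} (hε : 0 < ε) (hE : 1 / ε ≤ E) (hE2 : 2 ≤ E) {y : Data}
    (hy : IsApprox y ((NCSP Γ).count (reduced G M P E)) (1 / (4 * E))) :
    IsApprox (readOff (.pair (.num (finalStage G M P E).norm) y))
      ((NCSP (Γ ∪ {⟨n, R⟩})).count P) ε := by
  obtain ⟨h1, h2⟩ := H.card_bounds P.2 (L := (threshold D P.1 E).size)
    (S := finalStage G M P E) rfl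
  refine CountingCSP.isApprox_readOff (H.norm_pos _ _) hε hE hE2 h1 ?_ hy
  have hT := Nat.lt_size_self (threshold D P.1 E)
  change (NCSP Γ).count (reduced G M P E) * _ ≤ (NCSP (Γ ∪ {⟨n, R⟩})).count P * _ * _ + _ at h2
  change _ ≤ (NCSP Γ).count (reduced G M P E) at h1
  change (NCSP (Γ ∪ {⟨n, R⟩})).count P * _ ≤ _ at h1
  -- `X` is the total contribution of the non-solutions; `X * (4 * E) ≤ norm` has to be shown.
  obtain ⟨X, hX⟩ := Nat.exists_eq_add_of_le h1
  change (NCSP Γ).count (reduced G M P E) * (4 * E) ≤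
    (NCSP (Γ ∪ {⟨n, R⟩})).count P * (finalStage G M P E).norm * (4 * E) +
      (finalStage G M P E).norm
  rw [hX, add_mul, add_le_add_iff_left]
  rw [hX, add_mul, add_le_add_iff_left] at h2
  -- The factor `|D| ^ k` can only be cancelled if it is nonzero; if it is zero, the bound already
  -- gives `X = 0`.
  rcases Nat.eq_zero_or_pos (Nat.card D ^ P.1) with h0 | h0
  · rw [h0, zero_mul] at h2
    have hX0 : X = 0 := by
      rcases Nat.mul_eq_zero.1 (Nat.le_zero.1 h2) with h | h
      exacts [h, absurd h (by positivity)]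
    rw [hX0, zero_mul]
    exact Nat.zero_le _
  · refine Nat.le_of_mul_le_mul_left ?_ h0
    refine le_trans ?_ h2
    rw [threshold] at hT
    calc _ = X * (4 * E * Nat.card D ^ P.1) := by ring
      _ ≤ _ := Nat.mul_le_mul_left _ hT.le

end Reduction

/-! ### Error bounds and reductions with a single oracle call -/

theorem size_ceil_le {ε : ℝ} (hε : 0 < ε) :
    Nat.size ⌈1 / ε⌉₊ ≤ ⌈Real.logb 2 (1 / ε)⌉₊ + 1 := by
  rw [Nat.size_le]
  refine lt_of_le_of_lt ?_ (Nat.pow_lt_pow_right one_lt_two (Nat.lt_succ_self _))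
  rw [Nat.ceil_le]
  push_cast
  have h := Nat.le_ceil (Real.logb 2 (1 / ε))
  rwa [Real.logb_le_iff_le_rpow one_lt_two (by positivity), Real.rpow_natCast] at h

theorem logb_four_mul_ceil_le {ε : ℝ} (hε : 0 < ε) :
    Real.logb 2 (4 * ⌈1 / ε⌉₊) ≤ (⌈Real.logb 2 (1 / ε)⌉₊ + 3 : ℕ) := by
  have hpos : 0 < ⌈1 / ε⌉₊ := Nat.ceil_pos.2 (by positivity)
  rw [Real.logb_le_iff_le_rpow one_lt_two (by positivity), Real.rpow_natCast]
  have h := Nat.size_le.1 (size_ceil_le hε)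
  have : 4 * ⌈1 / ε⌉₊ ≤ 2 ^ (⌈Real.logb 2 (1 / ε)⌉₊ + 3) := by
    rw [pow_succ] at h
    rw [pow_add]
    omega
  exact_mod_cast this

/-- A reduction that consists of one oracle call between two polynomial-time computations. -/
theorem apReducible_of_polyTime {A B : CountingProblem} (red : A.Inst → ℕ → B.Inst)
    (aux : A.Inst → ℕ → Data) (post : Data → Data)
    (hred : PolyTime (fun x : A.Inst × ℕ => (Data.pair (A.encode x.1) (.num x.2)).size)
      (fun x => .pair (A.encode x.1) (.num x.2))
      fun x => .pair (aux x.1 x.2) (.pair (B.encode (red x.1 x.2)) (.num (4 * x.2))))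
    (hpost : PolyTime Data.size (fun x => x) post)
    (happ : ∀ (P : A.Inst) (E : ℕ) (ε : ℝ), 0 < ε → 1 / ε ≤ E → 2 ≤ E → ∀ y,
      IsApprox y (B.count (red P E)) (1 / (4 * E)) → IsApprox (post (.pair (aux P E) y))
        (A.count P) ε) : APReducible A B := by
  obtain ⟨V, hV⟩ := hred.size_right
  obtain ⟨p, T, hp⟩ := hred
  obtain ⟨p', T', hp'⟩ := hpost
  have hE2 : ∀ ε : ℝ, 0 < ε → ε < 1 → 2 ≤ ⌈1 / ε⌉₊ := fun ε h0 h1 =>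
    Nat.lt_ceil.2 (by rw [Nat.cast_one, lt_div_iff₀ h0]; linarith)
  have hquery : ∀ (P : A.Inst) (ε : ℝ), 0 < ε → ε < 1 →
      (0 : ℝ) < 1 / (4 * ⌈1 / ε⌉₊) ∧ (1 : ℝ) / (4 * ⌈1 / ε⌉₊) < 1 ∧
      Data.pair (B.encode (red P ⌈1 / ε⌉₊)) (.num (4 * ⌈1 / ε⌉₊)) =
        B.input (red P ⌈1 / ε⌉₊) (1 / (4 * ⌈1 / ε⌉₊)) := by
    intro P ε h0 h1
    have h2 : (2 : ℝ) ≤ ⌈1 / ε⌉₊ := by exact_mod_cast hE2 ε h0 h1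
    refine ⟨by positivity, ?_, ?_⟩
    · rw [div_lt_one (by positivity)]; linarith
    -- For `δ = 1 / (4 * E)` the number `1 / δ` is already an integer, so rounding up reproduces the
    -- numeral `4 * E`.
    · rw [CountingProblem.input, one_div_one_div]
      congr 2
      rw [← Nat.ceil_natCast (R := ℝ) (4 * ⌈1 / ε⌉₊)]
      push_cast
      rfl
  have hinput : ∀ (P : A.Inst) (ε : ℝ), 0 < ε →
      (A.input P ε).size ≤ A.parameter P ε + 3 := by
    intro P ε h0
    have := size_ceil_le h0
    simp only [CountingProblem.input, CountingProblem.parameter, Data.size]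
    omega
  -- The run is exhibited explicitly for every oracle; by determinism, what holds for it holds for
  -- any run mentioned in `APReducible`.
  have hrun : ∀ (O : Data → Data) (P : A.Inst) (ε : ℝ), 0 < ε → ε < 1 →
      ∃ t ≤ T.eval (A.parameter P ε + 3) +
          (2 * (Data.pair (aux P ⌈1 / ε⌉₊) (.pair (B.encode (red P ⌈1 / ε⌉₊))
            (.num (4 * ⌈1 / ε⌉₊)))).size + 2 * (Data.pair (B.encode (red P ⌈1 / ε⌉₊))
              (.num (4 * ⌈1 / ε⌉₊))).size + (aux P ⌈1 / ε⌉₊).size +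
            (O (.pair (B.encode (red P ⌈1 / ε⌉₊)) (.num (4 * ⌈1 / ε⌉₊)))).size + 2 +
          T'.eval ((aux P ⌈1 / ε⌉₊).size +
            (O (.pair (B.encode (red P ⌈1 / ε⌉₊)) (.num (4 * ⌈1 / ε⌉₊)))).size + 1) + 1) + 1,
        Run O (.seq p (.seq (.fork (.op .fst) (.seq (.op .snd) .oracle)) p')) (A.input P ε)
          (post (.pair (aux P ⌈1 / ε⌉₊)
            (O (.pair (B.encode (red P ⌈1 / ε⌉₊)) (.num (4 * ⌈1 / ε⌉₊)))))) t
          [.pair (B.encode (red P ⌈1 / ε⌉₊)) (.num (4 * ⌈1 / ε⌉₊))] := by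
    intro O P ε h0 h1
    obtain ⟨t, ht, hr⟩ := hp O (P, ⌈1 / ε⌉₊)
    obtain ⟨t', ht', hr'⟩ := hp' O (.pair (aux P ⌈1 / ε⌉₊)
      (O (.pair (B.encode (red P ⌈1 / ε⌉₊)) (.num (4 * ⌈1 / ε⌉₊)))))
    have hmono := eval_mono T (hinput P ε h0)
    refine ⟨_, ?_, Run.seq hr (Run.seq (Run.fork (Run.op _ _) (Run.seq (Run.op _ _)
      (Run.oracle _))) hr')⟩
    simp only [Op.eval, Data.size, CountingProblem.input] at hmono ht ht' ⊢
    omega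
  refine ⟨.seq p (.seq (.fork (.op .fst) (.seq (.op .snd) .oracle)) p'),
    ⟨Polynomial.X + 3, ?_⟩, ?_, ?_⟩
  · intro O P ε h0 h1 y t Q h c hc
    obtain ⟨t', -, h'⟩ := hrun O P ε h0 h1
    obtain ⟨-, -, rfl⟩ := h.deterministic h'
    obtain ⟨hδ0, hδ1, hq⟩ := hquery P ε h0 h1
    refine ⟨red P ⌈1 / ε⌉₊, _, hδ0, hδ1, (List.mem_singleton.1 hc).trans hq, ?_⟩
    rw [one_div_one_div]
    refine (logb_four_mul_ceil_le h0).trans ?_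
    rw [Nat.cast_le]
    simp [CountingProblem.parameter]
  · intro O hO P ε h0 h1 y t Q h
    obtain ⟨t', -, h'⟩ := hrun O P ε h0 h1
    obtain ⟨rfl, -, -⟩ := h.deterministic h'
    obtain ⟨hδ0, hδ1, hq⟩ := hquery P ε h0 h1
    refine happ P _ ε h0 (Nat.le_ceil _) (hE2 ε h0 h1) _ ?_
    rw [hq]
    exact hO _ _ hδ0 hδ1
  · intro r
    -- `W` bounds the output of the first computation, hence also the query and the auxiliary datum.
    -- The answer then has length at most `r.comp W`, which bounds the input of the last
    -- computation.
    let W := V.comp (Polynomial.X + 3)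
    refine ⟨T.comp (Polynomial.X + 3) + (5 * W + r.comp W + 2 + T'.comp (W + r.comp W + 1) + 1) + 1,
      fun O hO P ε h0 h1 => ?_⟩
    obtain ⟨t, ht, h⟩ := hrun O P ε h0 h1
    refine ⟨_, t, _, h, ht.trans ?_⟩
    have hVW : (Data.pair (aux P ⌈1 / ε⌉₊) (.pair (B.encode (red P ⌈1 / ε⌉₊))
        (.num (4 * ⌈1 / ε⌉₊)))).size ≤ W.eval (A.parameter P ε) := by
      refine (hV (P, ⌈1 / ε⌉₊)).trans ?_
      rw [Polynomial.eval_comp]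
      refine eval_mono V ?_
      rw [Polynomial.eval_add, Polynomial.eval_X, Polynomial.eval_ofNat]
      exact hinput P ε h0
    have hq : (Data.pair (B.encode (red P ⌈1 / ε⌉₊)) (.num (4 * ⌈1 / ε⌉₊))).size ≤
        W.eval (A.parameter P ε) := by
      rw [Data.size] at hVW
      omega
    have haux : (aux P ⌈1 / ε⌉₊).size ≤ W.eval (A.parameter P ε) := by
      rw [Data.size] at hVW
      omega
    have hans := (hO (.pair (B.encode (red P ⌈1 / ε⌉₊)) (.num (4 * ⌈1 / ε⌉₊)))).trans
      (eval_mono r hq)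
    have hT' := eval_mono T' (Nat.add_le_add_right (Nat.add_le_add haux hans) 1)
    simp only [Polynomial.eval_add, Polynomial.eval_comp, Polynomial.eval_mul, Polynomial.eval_X,
      Polynomial.eval_one, Polynomial.eval_ofNat] at hans hT' ⊢
    omega

end CountingCSP

theorem mainTheorem2 {D : Type*} [Finite D] (Γ : Set (CountingCSP.Rel D)) (hΓ : Γ.Finite)
    {n : ℕ} (R : Set (Fin n → D)) (hR : CountingCSP.HasMaxImplementation Γ R) :
    CountingCSP.APReducible (CountingCSP.NCSP (Γ ∪ {⟨n, R⟩})) (CountingCSP.NCSP Γ) := by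
  obtain ⟨q, G, M, H⟩ := hR.exists_isGadget
  exact CountingCSP.apReducible_of_polyTime (CountingCSP.reduced G M)
    (fun P E => .num (CountingCSP.finalStage G M P E).norm) CountingCSP.readOff
    (CountingCSP.polyTime_reduced G M hΓ) CountingCSP.polyTime_readOff
    fun P _ _ hε hE hE2 _ hy => H.isApprox_readOff P hε hE hE2 hy
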